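/- Let $E_8^3$ be the lattice of all $(m_1,m_2,m_3,m_4)$ with all $m_i\in\mathbb Z$ or all $m_i\in\mathbb Z+\frac12$ and with $\sum m_i$ even, with norm $m_1^2+m_2^2+3m_3^2+3m_4^2$; let $E_8^3(-2)$ be the same lattice with all norms multiplied by $-2$, and let $II_{1,1}=\mathbb Z^2$ with norm $(m,n)^2=-2mn$. Let $L=E_8^3(-2)\oplus II_{1,1}$, an even Lorentzian lattice of signature $(1,5)$, with elements $(r,m,n)$. A root of $L$ is a primitive vector $\alpha\in L$ with $\alpha^2<0$ such that the reflection $x\mapsto x-\frac{2(x,\alpha)}{\alpha^2}\alpha$ is an automorphism of $L$. Let $\mathrm{Aut}(L)^+$ be the group of automorphisms of $L$ that map each of the two cones of positive norm vectors of $L\otimes\mathbb R$ to itself, and let the reflection group $W\subset \mathrm{Aut}(L)^+$ be generated by the reflections in the roots of $L$. The vectors of norm $1$ in one of the two cones form a copy of hyperbolic space, which the hyperplanes $\alpha^\perp$ of the roots divide into (closed) Weyl chambers. The simple roots of a Weyl chamber $D$ are the roots $\alpha$ with $(\alpha,x)\ge 0$ for all $x\in D$ such that $D\cap\alpha^\perp$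 is a face of codimension one of $D$; a Weyl vector of $D$ is a $\rho\in L\otimes\mathbb R$ with $(\rho,\alpha)=\alpha^2/2$ for all simple roots $\alpha$ of $D$. Then $L$ has 8 simple roots (that is, each Weyl chamber has exactly 8 simple roots), and they can be taken to be the roots $\alpha$ of $L$ with $$(\rho,\alpha)=\alpha^2/2,\qquad \rho=(r,-6,7),\quad r=(5,0,1,0),$$ that is, there is a Weyl chamber whose simple roots are exactly these roots and whose unique Weyl vector is $\rho$. Moreover $\rho^2=28$. The reflection group $W$ has index 2 in $\mathrm{Aut}(L)^+$. The Dynkin diagram of the simple roots is a cycle with 8 vertices whose consecutive vertices are joined by $2,2,3,1,2,2,1,3$ lines, in this cyclic order; here $0,1,2,3$ lines between two simple roots mean that their hyperplanes meet at the angle $\pi/2,\pi/3,\pi/4,\pi/6$, respectively. -/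

import Mathlib

namespace HypLattice

/-! ### Lattices in a real vector space with a symmetric bilinear form -/

section General

variable {V : Type*} [AddCommGroup V] [Module ℝ V]

/-- The automorphism group `Aut(L)`, as a group of linear isometries of the ambient space
`V = L ⊗ ℝ` which map `L` onto itself. -/
def autGroup (B : LinearMap.BilinForm ℝ V) (L : Submodule ℤ V) : Subgroup (V ≃ₗ[ℝ] V) where
  carrier := {g | (∀ x y, B (g x) (g y) = B x y) ∧ ∀ x, g x ∈ L ↔ x ∈ L}
  one_mem' := by simp
  mul_mem' := by
    rintro g h ⟨hg, hgL⟩ ⟨hh, hhL⟩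
    refine ⟨fun x y => ?_, fun x => ?_⟩
    · rw [LinearEquiv.mul_apply, LinearEquiv.mul_apply, hg, hh]
    · rw [LinearEquiv.mul_apply, hgL, hhL]
  inv_mem' := by
    rintro g ⟨hg, hgL⟩
    have key : ∀ x, g (g⁻¹ x) = x := fun x => g.apply_symm_apply x
    refine ⟨fun x y => ?_, fun x => ?_⟩
    · rw [← hg, key, key]
    · rw [← hgL, key]

/-- The linear map `x ↦ x - (2 (α, x) / α²) α`, which is the reflection in `α^⊥` if `α² ≠ 0`. -/
noncomputable def reflectionMap (B : LinearMap.BilinForm ℝ V) (α : V) : V →ₗ[ℝ] V :=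
  LinearMap.id - ((2 / B α α) • B α).smulRight α

/-- A primitive vector of `L`: not a multiple of a vector of `L` by an integer other than `±1`. -/
def IsPrimitive (L : Submodule ℤ V) (α : V) : Prop :=
  α ∈ L ∧ ∀ (n : ℤ) (β : V), β ∈ L → α = n • β → IsUnit n

/-- A root of `L`: a primitive vector of negative norm whose reflection is an automorphism
of `L`. -/
def IsRoot (B : LinearMap.BilinForm ℝ V) (L : Submodule ℤ V) (α : V) : Prop :=
  IsPrimitive L α ∧ B α α < 0 ∧ ∃ g ∈ autGroup B L, (g : V →ₗ[ℝ] V) = reflectionMap B α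

/-- The reflection group `W`: generated by the reflections in the roots of `L`. -/
def reflectionGroup (B : LinearMap.BilinForm ℝ V) (L : Submodule ℤ V) : Subgroup (V ≃ₗ[ℝ] V) :=
  Subgroup.closure {g | ∃ α, IsRoot B L α ∧ (g : V →ₗ[ℝ] V) = reflectionMap B α}

/-- The set `S` is described by the diagram `m`: its elements can be labelled by the vertices so
that vertices `i ≠ j` are joined by `m i j ∈ {0, 1, 2, 3}` lines, where `0`, `1`, `2`, `3` lines
mean that the hyperplanes of the two roots, both oriented inwards, meet at the angle `θ = π/2`,
`π/3`, `π/4`, `π/6`.  For negative norm vectors this reads `(α, β) ≥ 0` and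
`(α, β)² = cos² θ · α² β²` with `4 cos² θ = m i j`. -/
def HasDynkinDiagram {ι : Type*} (B : LinearMap.BilinForm ℝ V) (S : Set V) (m : ι → ι → ℕ) :
    Prop :=
  ∃ α : ι → V, Function.Injective α ∧ Set.range α = S ∧
    ∀ i j, i ≠ j → 0 ≤ B (α i) (α j) ∧
      4 * B (α i) (α j) ^ 2 = (m i j : ℝ) * (B (α i) (α i) * B (α j) (α j))

variable [TopologicalSpace V]

/-- The cones of positive norm vectors: the connected components of the set of all vectors of
positive norm (there are two of them if `B` is Lorentzian of dimension at least 2). -/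
def IsPositiveCone (B : LinearMap.BilinForm ℝ V) (C : Set V) : Prop :=
  ∃ x, 0 < B x x ∧ C = connectedComponentIn {y | 0 < B y y} x

/-- The subgroup `Aut(L)⁺` of the automorphisms that map each cone of positive norm vectors to
itself. -/
def autPlus (B : LinearMap.BilinForm ℝ V) (L : Submodule ℤ V) : Subgroup (V ≃ₗ[ℝ] V) where
  carrier := {g | g ∈ autGroup B L ∧ ∀ C, IsPositiveCone B C → g '' C = C}
  one_mem' := ⟨one_mem _, fun C _ => by simp⟩
  mul_mem' := by
    rintro g h ⟨hg, hgC⟩ ⟨hh, hhC⟩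
    refine ⟨mul_mem hg hh, fun C hC => ?_⟩
    have : (⇑(g * h) : V → V) = g ∘ h := rfl
    rw [this, Set.image_comp, hhC C hC, hgC C hC]
  inv_mem' := by
    rintro g ⟨hg, hgC⟩
    refine ⟨inv_mem hg, fun C hC => ?_⟩
    have : (⇑(g⁻¹) : V → V) ∘ g = id := funext fun x => g.symm_apply_apply x
    conv_lhs => rw [← hgC C hC]
    rw [← Set.image_comp, this, Set.image_id]

/-- The vectors of norm `1` in a cone of positive norm vectors: a copy of hyperbolic space. -/
def hyperbolicSpace (B : LinearMap.BilinForm ℝ V) (C : Set V) : Set V :=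
  {x | x ∈ C ∧ B x x = 1}

/-- The (closed) Weyl chambers of `L`: the closures of the connected components of the
complement of all reflection hyperplanes in hyperbolic space. -/
def IsWeylChamber (B : LinearMap.BilinForm ℝ V) (L : Submodule ℤ V) (D : Set V) : Prop :=
  ∃ C, IsPositiveCone B C ∧
    ∃ x ∈ {y | y ∈ hyperbolicSpace B C ∧ ∀ α, IsRoot B L α → B α y ≠ 0},
      D = closure (connectedComponentIn
        {y | y ∈ hyperbolicSpace B C ∧ ∀ α, IsRoot B L α → B α y ≠ 0} x)

/-- The simple roots of a Weyl chamber `D`: the roots `α` that have nonnegative inner product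
with `D` and whose hyperplane `α^⊥` cuts out a face of `D` (a face of codimension one, so that
`D ∩ α^⊥` spans the hyperplane `α^⊥`). -/
def simpleRoots (B : LinearMap.BilinForm ℝ V) (L : Submodule ℤ V) (D : Set V) : Set V :=
  {α | IsRoot B L α ∧ (∀ x ∈ D, 0 ≤ B α x) ∧
    Submodule.span ℝ {x | x ∈ D ∧ B α x = 0} = LinearMap.ker (B α)}

/-- `ρ` is a Weyl vector for `D`: `(ρ, α) = α² / 2` for all simple roots `α` of `D`. -/
def IsWeylVector (B : LinearMap.BilinForm ℝ V) (L : Submodule ℤ V) (D : Set V) (ρ : V) : Prop :=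
  ∀ α ∈ simpleRoots B L D, B ρ α = B α α / 2

end General

/-! ### The lattice `E₈³(-2) ⊕ II₁,₁` -/

/-- The lattice `E₈³`: the vectors `(m₁, m₂, m₃, m₄)` with all `mᵢ ∈ ℤ` or all
`mᵢ ∈ ℤ + 1/2`, and with `∑ mᵢ` even. -/
def latticeE83 : Submodule ℤ (Fin 4 → ℝ) where
  carrier := {m | ((∀ i, ∃ k : ℤ, m i = k) ∨ (∀ i, ∃ k : ℤ, m i = k + 1 / 2)) ∧
    ∃ k : ℤ, ∑ i, m i = 2 * k}
  zero_mem' := ⟨Or.inl fun _ => ⟨0, by simp⟩, 0, by simp⟩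
  add_mem' := by
    rintro a b ⟨ha, s, hs⟩ ⟨hb, t, ht⟩
    refine ⟨?_, s + t, by simp only [Pi.add_apply, Finset.sum_add_distrib, hs, ht]; push_cast; ring⟩
    rcases ha with ha | ha <;> rcases hb with hb | hb
    · exact Or.inl fun i => by
        obtain ⟨k, hk⟩ := ha i
        obtain ⟨l, hl⟩ := hb i
        exact ⟨k + l, by rw [Pi.add_apply, hk, hl]; push_cast; ring⟩
    · exact Or.inr fun i => by
        obtain ⟨k, hk⟩ := ha i
        obtain ⟨l, hl⟩ := hb i
        exact ⟨k + l, by rw [Pi.add_apply, hk, hl]; push_cast; ring⟩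
    · exact Or.inr fun i => by
        obtain ⟨k, hk⟩ := ha i
        obtain ⟨l, hl⟩ := hb i
        exact ⟨k + l, by rw [Pi.add_apply, hk, hl]; push_cast; ring⟩
    · exact Or.inl fun i => by
        obtain ⟨k, hk⟩ := ha i
        obtain ⟨l, hl⟩ := hb i
        exact ⟨k + l + 1, by rw [Pi.add_apply, hk, hl]; push_cast; ring⟩
  smul_mem' := by
    rintro n a ⟨ha, s, hs⟩
    refine ⟨?_, n * s, ?_⟩
    · rcases ha with ha | ha
      · exact Or.inl fun i => by
          obtain ⟨k, hk⟩ := ha i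
          exact ⟨n * k, by rw [Pi.smul_apply, hk, zsmul_eq_mul]; push_cast; ring⟩
      · rcases Int.even_or_odd' n with ⟨q, hq | hq⟩
        · exact Or.inl fun i => by
            obtain ⟨k, hk⟩ := ha i
            exact ⟨n * k + q, by rw [Pi.smul_apply, hk, zsmul_eq_mul, hq]; push_cast; ring⟩
        · exact Or.inr fun i => by
            obtain ⟨k, hk⟩ := ha i
            exact ⟨n * k + q, by rw [Pi.smul_apply, hk, zsmul_eq_mul, hq]; push_cast; ring⟩
    · simp only [Pi.smul_apply, zsmul_eq_mul, ← Finset.mul_sum, hs]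
      push_cast
      ring

/-- The form of `E₈³`, with norm `m₁² + m₂² + 3 m₃² + 3 m₄²`. -/
noncomputable def formE83 : LinearMap.BilinForm ℝ (Fin 4 → ℝ) :=
  LinearMap.mk₂ ℝ (fun x y => x 0 * y 0 + x 1 * y 1 + 3 * (x 2 * y 2) + 3 * (x 3 * y 3))
    (fun x x' y => by simp only [Pi.add_apply]; ring)
    (fun c x y => by simp only [Pi.smul_apply, smul_eq_mul]; ring)
    (fun x y y' => by simp only [Pi.add_apply]; ring)
    (fun c x y => by simp only [Pi.smul_apply, smul_eq_mul]; ring)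

/-- The lattice `ℤ²`, underlying `II₁,₁`. -/
def latticeII : Submodule ℤ (ℝ × ℝ) where
  carrier := {p | ∃ m n : ℤ, p = ((m : ℝ), (n : ℝ))}
  zero_mem' := ⟨0, 0, by ext <;> simp⟩
  add_mem' := by
    rintro _ _ ⟨m, n, rfl⟩ ⟨m', n', rfl⟩
    exact ⟨m + m', n + n', by simp⟩
  smul_mem' := by
    rintro k _ ⟨m, n, rfl⟩
    exact ⟨k * m, k * n, by simp⟩

/-- The form of `II₁,₁`, with norm `(m, n)² = -2 m n`. -/
noncomputable def formII : LinearMap.BilinForm ℝ (ℝ × ℝ) :=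
  LinearMap.mk₂ ℝ (fun p q => -(p.1 * q.2 + p.2 * q.1))
    (fun x x' y => by simp only [Prod.fst_add, Prod.snd_add]; ring)
    (fun c x y => by simp only [Prod.smul_fst, Prod.smul_snd, smul_eq_mul]; ring)
    (fun x y y' => by simp only [Prod.fst_add, Prod.snd_add]; ring)
    (fun c x y => by simp only [Prod.smul_fst, Prod.smul_snd, smul_eq_mul]; ring)

/-- The ambient space of `E₈³(-2) ⊕ II₁,₁`, with elements `(r, (m, n))`. -/
abbrev Ambient : Type := (Fin 4 → ℝ) × (ℝ × ℝ)

/-- The lattice `L = E₈³(-2) ⊕ II₁,₁`. -/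
def latticeL : Submodule ℤ Ambient := latticeE83.prod latticeII

/-- The form of `L`: the form of `E₈³` multiplied by `-2`, plus the form of `II₁,₁`. -/
noncomputable def formL : LinearMap.BilinForm ℝ Ambient :=
  (-2 : ℝ) • formE83.compl₁₂ (LinearMap.fst ℝ (Fin 4 → ℝ) (ℝ × ℝ))
      (LinearMap.fst ℝ (Fin 4 → ℝ) (ℝ × ℝ)) +
    formII.compl₁₂ (LinearMap.snd ℝ (Fin 4 → ℝ) (ℝ × ℝ)) (LinearMap.snd ℝ (Fin 4 → ℝ) (ℝ × ℝ))

theorem formL_apply (x y : Ambient) :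
    formL x y = -2 * (x.1 0 * y.1 0 + x.1 1 * y.1 1 + 3 * (x.1 2 * y.1 2) + 3 * (x.1 3 * y.1 3))
      - (x.2.1 * y.2.2 + x.2.2 * y.2.1) := by
  simp [formL, formE83, formII]
  ring

/-- The vector `ρ = (r, -6, 7)` with `r = (5, 0, 1, 0)`. -/
def rho : Ambient := (![5, 0, 1, 0], (-6, 7))

/-- The number of lines between the vertices `k` and `k + 1` of the cyclic diagram with vertices
`0, …, 7` (and `7 + 1 = 0`). -/
def cycleBond : Fin 8 → ℕ := ![2, 2, 3, 1, 2, 2, 1, 3]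

/-- The cyclic diagram with 8 vertices and consecutive bonds `2, 2, 3, 1, 2, 2, 1, 3`. -/
def cycleDiagram (i j : Fin 8) : ℕ :=
  if j = i + 1 then cycleBond i else if i = j + 1 then cycleBond j else 0

end HypLattice

open HypLattice

namespace HypLattice

/-! The argument is Vinberg's theory of reflection groups, driven by a Weyl vector. Put `wv = -rho`,
a vector of norm 28 in one of the two positive cones, and call `(wv, β)` the height of `β`. A root
`β` of norm `-2d` has all its inner products with `L` divisible by `d`, and `d` divides 6. A finite
search then shows that no root has height 0, and that the roots of height exactly `d` are eight
explicit vectors, `sroot` (`enumeration`). Since `(wv, α) = -α²/2` for these, reflection in `α` adds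
`(β, α)` to the height of `β`.

Two facts replace the general theory. First, the cone where all eight inner products are nonnegative
lies in the closed positive cone (`formL_self_nonneg`), so every root, having negative norm, pairs
negatively with some simple root. Second, a simple reflection makes no positive root negative except
its own simple root (`eq_sroot_of_sign_change`): otherwise the Gram determinant of `wv`, `α` and `β`
would have the wrong sign. Descent on the height now writes every positive root as a nonnegative
combination of simple roots and as a conjugate of one. Hence the eight reflections generate `W`, and
no root hyperplane meets the interior of the chamber which the simple roots cut out.

Minimizing `(x, y)` over `y` in the orbit of `wv` moves any `x` of the positive cone into this
chamber, so all Weyl chambers are conjugate under `Aut(L)`. An automorphism of `L` which preserves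
the chamber permutes the simple roots and keeps their Gram matrix, so it is the identity or the one
symmetry of the diagram. That symmetry fixes `wv`, while by the exchange property only the identity
of `W` does (`eq_one_of_map_wv`). Therefore `W` has index 2. -/

open Filter Topology

/-! ### Integral coordinates on the lattice -/

/-- The vector with coordinates `(v₀/2, v₁/2, v₂/2, v₃/2; v₄, v₅)`. -/
noncomputable def vec (v : Fin 6 → ℤ) : Ambient :=
  (![(v 0 : ℝ) / 2, (v 1 : ℝ) / 2, (v 2 : ℝ) / 2, (v 3 : ℝ) / 2], ((v 4 : ℝ), (v 5 : ℝ)))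

/-- The congruences which say that `vec v` is in the lattice. -/
def InL (v : Fin 6 → ℤ) : Prop :=
  (v 0 - v 1) % 2 = 0 ∧ (v 0 - v 2) % 2 = 0 ∧ (v 0 - v 3) % 2 = 0 ∧
    (v 0 + v 1 + v 2 + v 3) % 4 = 0

/-- Minus twice the form in the integral coordinates. -/
def iform (u v : Fin 6 → ℤ) : ℤ :=
  u 0 * v 0 + u 1 * v 1 + 3 * (u 2 * v 2) + 3 * (u 3 * v 3) + 2 * (u 4 * v 5 + u 5 * v 4)

theorem formL_vec (u v : Fin 6 → ℤ) : formL (vec u) (vec v) = -(iform u v : ℝ) / 2 := by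
  simp [formL_apply, vec, iform]
  ring

theorem formL_comm (x y : Ambient) : formL x y = formL y x := by
  simp only [formL_apply]
  ring

theorem ambient_ext {x y : Ambient} (h0 : x.1 0 = y.1 0) (h1 : x.1 1 = y.1 1)
    (h2 : x.1 2 = y.1 2) (h3 : x.1 3 = y.1 3) (h4 : x.2.1 = y.2.1) (h5 : x.2.2 = y.2.2) :
    x = y := by
  refine Prod.ext (funext fun i => ?_) (Prod.ext h4 h5)
  fin_cases i <;> assumption

theorem vec_injective : Function.Injective vec := by
  intro u v h
  have h0 := congrArg (fun x : Ambient => x.1 0) h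
  have h1 := congrArg (fun x : Ambient => x.1 1) h
  have h2 := congrArg (fun x : Ambient => x.1 2) h
  have h3 := congrArg (fun x : Ambient => x.1 3) h
  have h4 := congrArg (fun x : Ambient => x.2.1) h
  have h5 := congrArg (fun x : Ambient => x.2.2) h
  simp [vec] at h0 h1 h2 h3 h4 h5
  funext i
  fin_cases i <;> assumption

theorem mem_latticeL_iff (x : Ambient) : x ∈ latticeL ↔ ∃ v, InL v ∧ vec v = x := by
  constructor
  · rintro ⟨⟨h, t, ht⟩, m, n, hmn⟩
    rw [Fin.sum_univ_four] at ht
    rcases h with h | h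
    · choose k hk using h
      refine ⟨![2 * k 0, 2 * k 1, 2 * k 2, 2 * k 3, m, n], ?_, ?_⟩
      · have : k 0 + k 1 + k 2 + k 3 = 2 * t := by
          simp only [hk] at ht; exact_mod_cast ht
        simp only [InL, Matrix.cons_val]
        omega
      · apply ambient_ext <;> simp_all [vec]
    · choose k hk using h
      refine ⟨![2 * k 0 + 1, 2 * k 1 + 1, 2 * k 2 + 1, 2 * k 3 + 1, m, n], ?_, ?_⟩
      · have : k 0 + k 1 + k 2 + k 3 + 2 = 2 * t := by
          have : (k 0 + k 1 + k 2 + k 3 + 2 : ℝ) = 2 * t := by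
            rw [← ht]; simp only [hk]; ring
          exact_mod_cast this
        simp only [InL, Matrix.cons_val]
        omega
      · apply ambient_ext <;> simp_all [vec] <;> ring
  · rintro ⟨v, ⟨h1, h2, h3, h4⟩, rfl⟩
    refine ⟨⟨?_, ?_⟩, v 4, v 5, rfl⟩
    · rcases Int.even_or_odd' (v 0) with ⟨a, ha | ha⟩
      · left
        have key : ∀ i : Fin 4, ∃ k : ℤ, ![v 0, v 1, v 2, v 3] i = 2 * k := by
          intro i
          fin_cases i <;> simp only [Fin.zero_eta, Fin.mk_one, Fin.reduceFinMk, Matrix.cons_val]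
          exacts [⟨a, ha⟩, ⟨v 1 / 2, by omega⟩, ⟨v 2 / 2, by omega⟩, ⟨v 3 / 2, by omega⟩]
        intro i
        obtain ⟨k, hk⟩ := key i
        refine ⟨k, ?_⟩
        have : (vec v).1 i = ((![v 0, v 1, v 2, v 3] i : ℤ) : ℝ) / 2 := by
          fin_cases i <;> rfl
        rw [show (vec v).1 i = _ from this, hk]; push_cast; ring
      · right
        have key : ∀ i : Fin 4, ∃ k : ℤ, ![v 0, v 1, v 2, v 3] i = 2 * k + 1 := by
          intro i
          fin_cases i <;> simp only [Fin.zero_eta, Fin.mk_one, Fin.reduceFinMk, Matrix.cons_val]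
          exacts [⟨a, ha⟩, ⟨v 1 / 2, by omega⟩, ⟨v 2 / 2, by omega⟩, ⟨v 3 / 2, by omega⟩]
        intro i
        obtain ⟨k, hk⟩ := key i
        refine ⟨k, ?_⟩
        have : (vec v).1 i = ((![v 0, v 1, v 2, v 3] i : ℤ) : ℝ) / 2 := by
          fin_cases i <;> rfl
        rw [show (vec v).1 i = _ from this, hk]; push_cast; ring
    · refine ⟨(v 0 + v 1 + v 2 + v 3) / 4, ?_⟩
      obtain ⟨c, hc⟩ : ∃ c, v 0 + v 1 + v 2 + v 3 = 4 * c := ⟨(v 0 + v 1 + v 2 + v 3) / 4, by omega⟩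
      have hc' : (v 0 + v 1 + v 2 + v 3 : ℝ) = 4 * c := by exact_mod_cast hc
      rw [hc, Int.mul_ediv_cancel_left _ (by norm_num), Fin.sum_univ_four]
      simp only [vec, Matrix.cons_val]
      linarith

theorem vec_mem {v : Fin 6 → ℤ} (h : InL v) : vec v ∈ latticeL := (mem_latticeL_iff _).2 ⟨v, h, rfl⟩

/-- This is the evenness of `L`: the coefficients 1, 1, 3, 3 add up to 8, and the first four
coordinates agree modulo 2. -/
theorem iform_self {v : Fin 6 → ℤ} (hv : InL v) : ∃ z, iform v v = 4 * z := by
  obtain ⟨k1, k2, k3, k4⟩ := hv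
  obtain ⟨a', ha'⟩ : ∃ a, v 1 = v 0 + 2 * a := ⟨(v 1 - v 0) / 2, by omega⟩
  obtain ⟨b', hb'⟩ : ∃ b, v 2 = v 0 + 2 * b := ⟨(v 2 - v 0) / 2, by omega⟩
  obtain ⟨c', hc'⟩ : ∃ c, v 3 = v 0 + 2 * c := ⟨(v 3 - v 0) / 2, by omega⟩
  refine ⟨2 * (v 0 * v 0) + v 0 * (a' + 3 * b' + 3 * c')
    + (a' * a' + 3 * b' * b' + 3 * c' * c') + v 4 * v 5, ?_⟩
  rw [iform, ha', hb', hc']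
  ring

/-! ### The simple roots -/

/-- The integral coordinates of the simple roots, in the cyclic order of the diagram. -/
def simpleCoord : Fin 8 → Fin 6 → ℤ :=
  ![![0, 0, 2, -2, 0, 0], ![-6, 0, -2, 0, 3, -3], ![0, 0, 2, 2, 0, 0], ![1, 1, -1, -1, 0, 0],
    ![-2, -2, 0, 0, 0, -2], ![0, 0, 0, 0, 1, 1], ![-2, 2, 0, 0, 0, -2], ![1, -1, -1, 1, 0, 0]]

/-- The simple roots. -/
noncomputable def sroot (i : Fin 8) : Ambient := vec (simpleCoord i)

/-- Minus half the norms of the simple roots. -/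
def sd : Fin 8 → ℤ := ![6, 3, 6, 2, 2, 1, 2, 2]

/-- The Gram matrix of the simple roots. -/
def gram (i j : Fin 8) : ℤ := -iform (simpleCoord i) (simpleCoord j) / 2

/-- The negative of the Weyl vector. -/
noncomputable def wv : Ambient := vec ![-10, 0, -2, 0, 6, -7]

theorem wv_eq : wv = -rho := by
  apply ambient_ext <;> simp [wv, rho, vec] <;> norm_num

theorem formL_sroot (i j : Fin 8) : formL (sroot i) (sroot j) = gram i j := by
  have h : ∀ i j, -iform (simpleCoord i) (simpleCoord j) = 2 * gram i j := by decide
  have h' : -(iform (simpleCoord i) (simpleCoord j) : ℝ) = 2 * gram i j := by exact_mod_cast h i j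
  rw [sroot, sroot, formL_vec, h']
  ring

theorem gram_self (i : Fin 8) : gram i i = -2 * sd i := by revert i; decide
theorem gram_nonneg {i j : Fin 8} : i ≠ j → 0 ≤ gram i j := by revert i j; decide
theorem sd_pos (i : Fin 8) : 0 < sd i := by revert i; decide
theorem sd_le (i : Fin 8) : sd i ≤ 6 := by revert i; decide
theorem simpleCoord_inL (i : Fin 8) : InL (simpleCoord i) := by
  revert i; unfold InL; decide

theorem sroot_injective : Function.Injective sroot :=
  vec_injective.comp (by decide)

theorem formL_wv_sroot (i : Fin 8) : formL wv (sroot i) = sd i := by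
  have h : ∀ i, -iform ![-10, 0, -2, 0, 6, -7] (simpleCoord i) = 2 * sd i := by decide
  have h' : -(iform ![-10, 0, -2, 0, 6, -7] (simpleCoord i) : ℝ) = 2 * sd i := by
    exact_mod_cast h i
  rw [sroot, wv, formL_vec, h']
  ring

theorem formL_wv_wv : formL wv wv = 28 := by
  rw [wv, formL_vec]; simp [iform]; norm_num

theorem wv_inL : InL ![-10, 0, -2, 0, 6, -7] := by unfold InL; decide

/-- A vector is determined by its inner products with the simple roots. -/
theorem eq_of_formL_sroot {x y : Ambient} (h : ∀ i, formL x (sroot i) = formL y (sroot i)) :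
    x = y := by
  have h0 := h 0
  have h1 := h 1
  have h2 := h 2
  have h3 := h 3
  have h4 := h 4
  have h5 := h 5
  have h6 := h 6
  have h7 := h 7
  simp [formL_apply, sroot, vec, simpleCoord] at h0 h1 h2 h3 h4 h5 h6 h7
  apply ambient_ext <;> linarith

/-- The cone cut out by the simple roots lies in the closed positive cone. -/
theorem formL_self_nonneg {x : Ambient} (h : ∀ i, 0 ≤ formL x (sroot i)) : 0 ≤ formL x x := by
  have h0 := h 0
  have h1 := h 1
  have h2 := h 2
  have h3 := h 3
  have h4 := h 4
  have h5 := h 5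
  have h6 := h 6
  have h7 := h 7
  simp [formL_apply, sroot, vec, simpleCoord] at h0 h1 h2 h3 h4 h5 h6 h7
  rw [formL_apply]
  obtain ⟨a, ha⟩ : ∃ a, x.1 0 = -a := ⟨-x.1 0, by ring⟩
  obtain ⟨c, hc⟩ : ∃ c, x.1 2 = -c := ⟨-x.1 2, by ring⟩
  obtain ⟨l, hl⟩ : ∃ l, x.2.2 = -l := ⟨-x.2.2, by ring⟩
  simp only [ha, hc, hl] at h0 h1 h2 h3 h4 h5 h6 h7 ⊢
  clear ha hc hl h
  generalize x.1 1 = b at *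
  generalize x.1 3 = e at *
  generalize x.2.1 = m at *
  -- With the signs changed, the norm is nonnegative exactly when `a² + b² + 3c² + 3e² ≤ ml`, and
  -- the next inequalities restate the eight conditions.
  have he : |e| ≤ c := abs_le.2 ⟨by linarith, by linarith⟩
  have hb : |b| + a ≤ m := by
    rcases abs_cases b with ⟨h, _⟩ | ⟨h, _⟩ <;> rw [h] <;> linarith
  have hac : 3 * c ≤ a := by linarith
  have hml : m ≤ l := by linarith
  have hml2 : 2 * a + 2 * c ≤ m + l := by linarith
  have hc0 : 0 ≤ c := (abs_nonneg e).trans he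
  have hb0 := abs_nonneg b
  have hee : e * e ≤ c * c := by nlinarith [abs_nonneg e, abs_mul_abs_self e]
  have hbb := abs_mul_abs_self b
  generalize |b| = b' at *
  have : a * a + b * b + 3 * (c * c) + 3 * (e * e) ≤ m * l := by
    rcases le_total (a + c) m with hm | hm
    · rcases le_total b' c with hbc | hbc
      · nlinarith [mul_le_mul hm (hm.trans hml) (by linarith) (by linarith)]
      · nlinarith [mul_le_mul hb (hb.trans hml) (by linarith) (by linarith)]
    -- Here `l ≥ 2a + 2c - m`, and `m (2a + 2c - m)` is a concave function of `m` taking the same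
    -- value at `a + b'` and `a + 2c - b'`. Since `m` lies between these points, the endpoint value
    -- is a lower bound for `ml`.
    · have h1 : (m - a - b') * (a + 2 * c - b' - m) + (a + b') * (a + 2 * c - b') ≤ m * l := by
        nlinarith
      have h2 : 0 ≤ (m - a - b') * (a + 2 * c - b' - m) := by
        apply mul_nonneg <;> linarith
      nlinarith
  linarith

/-! ### Reflections and roots -/

theorem reflectionMap_apply (α x : Ambient) :
    reflectionMap formL α x = x - (2 / formL α α * formL α x) • α := by
  simp [reflectionMap]

theorem reflectionMap_involutive (α : Ambient) : Function.Involutive (reflectionMap formL α) := by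
  intro x
  -- For `α² = 0` the quotient `2 / 0` is 0 and the map is the identity, so involutivity needs no
  -- hypothesis.
  rcases eq_or_ne (formL α α) 0 with h | h
  · simp [reflectionMap_apply, h]
  · rw [reflectionMap_apply α x, map_sub, map_smul, reflectionMap_apply α x,
      reflectionMap_apply α α, div_mul_cancel₀ _ h, two_smul]
    module

/-- The reflection in `α^⊥` as a linear equivalence. -/
noncomputable def refl (α : Ambient) : Ambient ≃ₗ[ℝ] Ambient :=
  LinearEquiv.ofInvolutive (reflectionMap formL α) (reflectionMap_involutive α)

theorem refl_apply (α x : Ambient) : refl α x = x - (2 / formL α α * formL α x) • α :=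
  reflectionMap_apply α x

theorem refl_refl (α x : Ambient) : refl α (refl α x) = x := reflectionMap_involutive α x

theorem refl_mul_refl (α : Ambient) : refl α * refl α = 1 := LinearEquiv.ext (refl_refl α)

theorem refl_inv (α : Ambient) : (refl α)⁻¹ = refl α := inv_eq_of_mul_eq_one_left (refl_mul_refl α)

theorem eq_refl_of_coe {g : Ambient ≃ₗ[ℝ] Ambient} {α : Ambient}
    (h : (g : Ambient →ₗ[ℝ] Ambient) = reflectionMap formL α) : g = refl α :=
  LinearEquiv.toLinearMap_injective h

theorem refl_neg (α : Ambient) : refl (-α) = refl α := by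
  ext1 x
  simp [refl_apply]

theorem refl_self {α : Ambient} (h : formL α α ≠ 0) : refl α α = -α := by
  rw [refl_apply, div_mul_cancel₀ _ h, two_smul]
  abel

theorem formL_refl (α x y : Ambient) : formL (refl α x) (refl α y) = formL x y := by
  rcases eq_or_ne (formL α α) 0 with h | h
  · simp [refl_apply, h]
  · simp only [refl_apply, map_sub, map_smul, LinearMap.sub_apply, LinearMap.smul_apply,
      smul_eq_mul, formL_comm x α]
    field_simp
    ring

theorem formL_map {g : Ambient ≃ₗ[ℝ] Ambient} (hg : g ∈ autGroup formL latticeL) (x y : Ambient) :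
    formL (g x) (g y) = formL x y := hg.1 x y

theorem map_mem_iff {g : Ambient ≃ₗ[ℝ] Ambient} (hg : g ∈ autGroup formL latticeL) (x : Ambient) :
    g x ∈ latticeL ↔ x ∈ latticeL := hg.2 x

theorem refl_map {g : Ambient ≃ₗ[ℝ] Ambient} (hg : g ∈ autGroup formL latticeL) (α : Ambient) :
    refl (g α) = g * refl α * g⁻¹ := by
  ext1 x
  have hx : g (g⁻¹ x) = x := g.apply_symm_apply x
  have h : formL (g α) x = formL α (g⁻¹ x) := by
    conv_lhs => rw [← hx]
    exact formL_map hg _ _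
  simp only [LinearEquiv.mul_apply, refl_apply, map_sub, map_smul, h, hx, formL_map hg]

theorem refl_mem_autGroup {β : Ambient} (hβ : β ∈ latticeL)
    (h : ∀ x ∈ latticeL, ∃ z : ℤ, 2 / formL β β * formL β x = z) :
    refl β ∈ autGroup formL latticeL := by
  have key : ∀ x ∈ latticeL, refl β x ∈ latticeL := by
    intro x hx
    obtain ⟨z, hz⟩ := h x hx
    rw [refl_apply, hz, Int.cast_smul_eq_zsmul]
    exact sub_mem hx (latticeL.smul_mem z hβ)
  refine ⟨formL_refl β, fun x => ⟨fun hx => ?_, key x⟩⟩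
  rw [← refl_refl β x]
  exact key _ hx

theorem IsRoot.refl_mem {β : Ambient} (h : IsRoot formL latticeL β) :
    refl β ∈ autGroup formL latticeL := by
  obtain ⟨_, _, g, hg, hgβ⟩ := h
  rwa [← eq_refl_of_coe hgβ]

theorem IsRoot.map {β : Ambient} (h : IsRoot formL latticeL β) {g : Ambient ≃ₗ[ℝ] Ambient}
    (hg : g ∈ autGroup formL latticeL) : IsRoot formL latticeL (g β) := by
  refine ⟨⟨(map_mem_iff hg β).2 h.1.1, fun n γ hγ hn => ?_⟩, ?_, refl (g β), ?_, rfl⟩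
  · refine h.1.2 n (g⁻¹ γ) ((map_mem_iff (inv_mem hg) γ).2 hγ) ?_
    have := congrArg (g⁻¹ : Ambient ≃ₗ[ℝ] Ambient) hn
    rw [map_zsmul] at this
    rw [← this]
    exact (g.symm_apply_apply β).symm
  · rw [formL_map hg]
    exact h.2.1
  · rw [refl_map hg]
    exact mul_mem (mul_mem hg h.refl_mem) (inv_mem hg)

theorem neg_one_mem_autGroup : LinearEquiv.neg ℝ ∈ autGroup formL latticeL :=
  ⟨fun x y => by simp, fun x => by simp⟩

theorem IsRoot.neg {β : Ambient} (h : IsRoot formL latticeL β) : IsRoot formL latticeL (-β) :=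
  h.map neg_one_mem_autGroup

/-! ### Divisibility properties of roots -/

theorem smul_vec_coord {c : ℝ} {u v : Fin 6 → ℤ} (h : c • vec v = vec u) (i : Fin 6) :
    c * v i = u i := by
  have h0 := congrArg (fun x : Ambient => x.1 0) h
  have h1 := congrArg (fun x : Ambient => x.1 1) h
  have h2 := congrArg (fun x : Ambient => x.1 2) h
  have h3 := congrArg (fun x : Ambient => x.1 3) h
  have h4 := congrArg (fun x : Ambient => x.2.1) h
  have h5 := congrArg (fun x : Ambient => x.2.2) h
  simp only [vec, Prod.smul_fst, Prod.smul_snd, Pi.smul_apply, smul_eq_mul, Matrix.cons_val]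
    at h0 h1 h2 h3 h4 h5
  fin_cases i <;> simp only [Fin.zero_eta, Fin.mk_one, Fin.reduceFinMk] <;> linarith

/-- The only multiples in the lattice of a primitive vector are the integral ones. -/
theorem IsPrimitive.int_of_smul_mem {β : Ambient} (h : IsPrimitive latticeL β) {c : ℝ}
    (hc : c • β ∈ latticeL) : ∃ n : ℤ, c = n := by
  obtain ⟨v, hv, rfl⟩ := (mem_latticeL_iff _).1 h.1
  obtain ⟨u, hu, huv⟩ := (mem_latticeL_iff _).1 hc
  have hcoord := smul_vec_coord huv.symm
  obtain ⟨i, hi⟩ : ∃ i, v i ≠ 0 := by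
    by_contra! h0
    have := h.2 0 (vec v) h.1 (by
      rw [zero_smul]; apply ambient_ext <;> simp [vec, h0])
    simp at this
  -- A nonzero coordinate gives `c = p / q` in lowest terms. By Bézout `β` is `q` times an integral
  -- combination of `β` and `c • β`, so primitivity makes `q` a unit.
  obtain ⟨q, p, hqp, hq, hp⟩ := Int.exists_gcd_one (Int.gcd_pos_of_ne_zero_left (u i) hi)
  have hg : (Int.gcd (v i) (u i) : ℤ) ≠ 0 :=
    Int.natCast_ne_zero.2 (Int.gcd_pos_of_ne_zero_left (u i) hi).ne'
  generalize (Int.gcd (v i) (u i) : ℤ) = g at hq hp hg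
  have hcq : c * q = p := by
    have := hcoord i
    rw [hq, hp] at this
    push_cast at this
    have hg' : (g : ℝ) ≠ 0 := by exact_mod_cast hg
    exact mul_right_cancel₀ hg' (by linarith)
  have hbez := Int.gcd_eq_gcd_ab q p
  rw [hqp] at hbez
  have hunit := h.2 q (Int.gcdA q p • vec v + Int.gcdB q p • vec u)
    (add_mem (latticeL.smul_mem _ h.1) (latticeL.smul_mem _ (vec_mem hu))) (by
      simp only [← Int.cast_smul_eq_zsmul ℝ, huv, smul_smul, smul_add]
      have : ((q : ℝ) * Int.gcdA q p + q * Int.gcdB q p * c) = 1 := by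
        have hbez' : (1 : ℝ) = q * Int.gcdA q p + p * Int.gcdB q p := by exact_mod_cast hbez
        rw [hbez', ← hcq]
        ring
      rw [← add_smul, ← mul_assoc, this, one_smul])
  rcases Int.isUnit_iff.1 hunit with rfl | rfl
  · exact ⟨p, by simpa using hcq⟩
  · exact ⟨-p, by push_cast at hcq ⊢; linarith⟩

/-- Arithmetic data of a root: half its norm divides `6`, and divides all inner products. -/
theorem IsRoot.exists_coord {β : Ambient} (h : IsRoot formL latticeL β) :
    ∃ (v : Fin 6 → ℤ) (d : ℤ), InL v ∧ vec v = β ∧ 0 < d ∧ d ∣ 6 ∧ iform v v = 4 * d ∧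
      ∀ u, InL u → ∃ z, iform v u = 2 * (d * z) := by
  have hprim := h.1
  obtain ⟨v, hv, rfl⟩ := (mem_latticeL_iff _).1 h.1.1
  obtain ⟨d, hd⟩ := iform_self hv
  have hd' : formL (vec v) (vec v) = -2 * d := by
    rw [formL_vec, hd]; push_cast; ring
  have hdpos : 0 < d := by
    have h2 := h.2.1
    rw [hd'] at h2
    have : (0 : ℝ) < d := by linarith
    exact_mod_cast this
  have hdR : (d : ℝ) ≠ 0 := by exact_mod_cast hdpos.ne'
  have hdvd : ∀ u, InL u → ∃ z, iform v u = 2 * (d * z) := by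
    intro u hu
    have h1 := (map_mem_iff h.refl_mem (vec u)).2 (vec_mem hu)
    rw [refl_apply] at h1
    have h2 := sub_mem (vec_mem hu) h1
    rw [sub_sub_cancel] at h2
    obtain ⟨n, hn⟩ := hprim.int_of_smul_mem h2
    refine ⟨n, ?_⟩
    rw [hd', formL_vec] at hn
    field_simp at hn
    have : (iform v u : ℝ) = 2 * (d * n) := by linarith
    exact_mod_cast this
  refine ⟨v, d, hv, rfl, hdpos, ?_, hd, hdvd⟩
  -- The vector `β / d` has integral inner products with `L`. Testing against these eight lattice
  -- vectors is enough to put `(6 / d) • β` in `L`, and primitivity then gives `d ∣ 6`.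
  obtain ⟨z0, h0⟩ := hdvd ![1, 1, 1, 1, 0, 0] (by unfold InL; decide)
  obtain ⟨z1, h1⟩ := hdvd ![2, 2, 0, 0, 0, 0] (by unfold InL; decide)
  obtain ⟨z2, h2⟩ := hdvd ![2, -2, 0, 0, 0, 0] (by unfold InL; decide)
  obtain ⟨z3, h3⟩ := hdvd ![0, 0, 2, 2, 0, 0] (by unfold InL; decide)
  obtain ⟨z4, h4⟩ := hdvd ![0, 0, 2, -2, 0, 0] (by unfold InL; decide)
  obtain ⟨z5, h5⟩ := hdvd ![0, 0, 0, 0, 1, 0] (by unfold InL; decide)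
  obtain ⟨z6, h6⟩ := hdvd ![0, 0, 0, 0, 0, 1] (by unfold InL; decide)
  obtain ⟨z7, h7⟩ := hdvd ![2, 0, -2, 0, 0, 0] (by unfold InL; decide)
  simp only [iform, Matrix.cons_val] at h0 h1 h2 h3 h4 h5 h6 h7
  have hmem : ((6 / d : ℝ)) • vec v ∈ latticeL := by
    have e : (6 / d : ℝ) • vec v =
        vec ![3 * (z1 + z2), 3 * (z1 - z2), z3 + z4, z3 - z4, 6 * z6, 6 * z5] := by
      have e0 : (v 0 + v 1 : ℝ) = d * z1 := by exact_mod_cast (by linarith : v 0 + v 1 = d * z1)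
      have e1 : (v 0 - v 1 : ℝ) = d * z2 := by exact_mod_cast (by linarith : v 0 - v 1 = d * z2)
      have e2 : (3 * (v 2 + v 3) : ℝ) = d * z3 := by
        exact_mod_cast (by linarith : 3 * (v 2 + v 3) = d * z3)
      have e3 : (3 * (v 2 - v 3) : ℝ) = d * z4 := by
        exact_mod_cast (by linarith : 3 * (v 2 - v 3) = d * z4)
      have e4 : (v 5 : ℝ) = d * z5 := by exact_mod_cast (by linarith : v 5 = d * z5)
      have e5 : (v 4 : ℝ) = d * z6 := by exact_mod_cast (by linarith : v 4 = d * z6)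
      apply ambient_ext <;>
        simp only [vec, Prod.smul_fst, Prod.smul_snd, Pi.smul_apply, smul_eq_mul,
          Matrix.cons_val] <;> push_cast <;> field_simp <;> linarith
    rw [e]
    apply vec_mem
    have f0 : z1 + z3 = 2 * z0 := mul_left_cancel₀ hdpos.ne' (by linarith)
    have f1 : z1 + z2 - (z3 + z4) = 2 * z7 := mul_left_cancel₀ hdpos.ne' (by linarith)
    simp only [InL, Matrix.cons_val]
    omega
  obtain ⟨n, hn⟩ := hprim.int_of_smul_mem hmem
  refine ⟨n, ?_⟩
  field_simp at hn
  exact_mod_cast hn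

theorem sroot_dvd (i : Fin 8) {u : Fin 6 → ℤ} (hu : InL u) :
    ∃ z, iform (simpleCoord i) u = 2 * (sd i * z) := by
  obtain ⟨h1, h2, h3, h4⟩ := hu
  fin_cases i <;> simp only [Fin.zero_eta, Fin.mk_one, Fin.reduceFinMk, iform, simpleCoord, sd,
    Matrix.cons_val]
  · exact ⟨(u 2 - u 3) / 2, by omega⟩
  · exact ⟨-u 0 - u 2 + u 5 - u 4, by omega⟩
  · exact ⟨(u 2 + u 3) / 2, by omega⟩
  · exact ⟨(u 0 + u 1 - 3 * u 2 - 3 * u 3) / 4, by omega⟩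
  · exact ⟨(-u 0 - u 1) / 2 - u 4, by omega⟩
  · exact ⟨u 4 + u 5, by omega⟩
  · exact ⟨(-u 0 + u 1) / 2 - u 4, by omega⟩
  · exact ⟨(u 0 - u 1 - 3 * u 2 + 3 * u 3) / 4, by omega⟩

theorem isRoot_sroot (i : Fin 8) : IsRoot formL latticeL (sroot i) := by
  have hsd := sd_pos i
  have hsd' : (sd i : ℝ) ≠ 0 := by exact_mod_cast hsd.ne'
  have hnorm : formL (sroot i) (sroot i) = -2 * sd i := by
    rw [formL_sroot, gram_self]; push_cast; ring
  have hmem : sroot i ∈ latticeL := vec_mem (simpleCoord_inL i)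
  refine ⟨⟨hmem, fun n β hβ hn => ?_⟩, ?_, refl (sroot i), refl_mem_autGroup hmem ?_, rfl⟩
  · obtain ⟨u, hu, rfl⟩ := (mem_latticeL_iff _).1 hβ
    obtain ⟨z, hz⟩ := iform_self hu
    rw [hn] at hnorm
    simp only [← Int.cast_smul_eq_zsmul ℝ, map_smul, LinearMap.smul_apply, smul_eq_mul, formL_vec,
      hz] at hnorm
    -- By evenness `n²` divides half the norm, which is at most 6 and not a multiple of 4.
    have h1 : n * n * z = sd i := by
      have : (n * n * z : ℝ) = sd i := by push_cast at hnorm; linarith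
      exact_mod_cast this
    have hz0 : 0 < z := by nlinarith [mul_self_nonneg n]
    have h2 : n * n ≤ 6 := by nlinarith [sd_le i, mul_self_nonneg n]
    have h3 : n ≤ 2 := by nlinarith
    have h4 : -2 ≤ n := by nlinarith
    have h5 : ∀ j, ¬ (4 : ℤ) ∣ sd j := by decide
    have h6 : ¬ (4 : ℤ) ∣ n * n := fun h => h5 i (h1 ▸ h.mul_right z)
    rw [Int.isUnit_iff]
    interval_cases n <;> simp_all
  · rw [hnorm]
    have : (0 : ℝ) < sd i := by exact_mod_cast hsd
    linarith
  · intro x hx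
    obtain ⟨u, hu, rfl⟩ := (mem_latticeL_iff _).1 hx
    obtain ⟨z, hz⟩ := sroot_dvd i hu
    refine ⟨z, ?_⟩
    rw [hnorm, sroot, formL_vec, hz]
    push_cast
    field_simp

/-! ### Enumeration of the roots of small height -/

/-- The last two coordinates of a root are `d * m` and `d * k`, and its height is `d * e`. The bound
48 confines the first four coordinates to the boxes searched in `enumeration_check`. -/
theorem enumeration_bound : ∀ d ∈ ([1, 2, 3, 6] : List ℤ), ∀ e ∈ ([0, 1] : List ℤ),
    ∀ m ∈ ([-1, 0, 1] : List ℤ), ∀ k ∈ ([-2, -1, 0, 1] : List ℤ),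
    d * ((7 * m - 6 * k - e) * (7 * m - 6 * k - e) + 112 * (m * k)) ≤ 112 →
    4 * d - 4 * (d * m) * (d * k) ≤ 48 := by decide

-- The hypotheses are interleaved with the quantifiers so that the search is pruned early: the
-- height equation comes before `b` and `f` are chosen.
set_option synthInstance.maxHeartbeats 400000 in
set_option synthInstance.maxSize 1000 in
set_option maxRecDepth 100000 in
theorem enumeration_check : ∀ d ∈ ([1, 2, 3, 6] : List ℤ), ∀ e ∈ ([0, 1] : List ℤ),
    ∀ m ∈ ([-1, 0, 1] : List ℤ), ∀ k ∈ ([-2, -1, 0, 1] : List ℤ),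
    d * ((7 * m - 6 * k - e) * (7 * m - 6 * k - e) + 112 * (m * k)) ≤ 112 →
    ∀ c ∈ ([-4, -3, -2, -1, 0, 1, 2, 3, 4] : List ℤ),
    ∀ a ∈ ([-6, -5, -4, -3, -2, -1, 0, 1, 2, 3, 4, 5, 6] : List ℤ),
    5 * a + 3 * c = d * e - 7 * (d * m) + 6 * (d * k) →
    ∀ b ∈ ([-6, -5, -4, -3, -2, -1, 0, 1, 2, 3, 4, 5, 6] : List ℤ),
    (a - b) % 2 = 0 →
    ∀ f ∈ ([-4, -3, -2, -1, 0, 1, 2, 3, 4] : List ℤ),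
    (a - c) % 2 = 0 → (a - f) % 2 = 0 → (a + b + c + f) % 4 = 0 →
    a * a + b * b + 3 * (c * c) + 3 * (f * f) = 4 * d - 4 * (d * m) * (d * k) →
    e = 1 ∧ ∃ i, ![a, b, c, f, d * m, d * k] = simpleCoord i := by
  decide +kernel

/-- There are no roots of height `0`, and the only roots `β` of height `-β²/2` are the simple
roots. -/
theorem enumeration {v : Fin 6 → ℤ} (hv : InL v) {d e m k : ℤ} (hd : 0 < d) (hd6 : d ∣ 6)
    (hnorm : iform v v = 4 * d) (hm : v 4 = d * m) (hk : v 5 = d * k) (he : e = 0 ∨ e = 1)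
    (hs : 5 * v 0 + 3 * v 2 + 7 * v 4 - 6 * v 5 = d * e) :
    e = 1 ∧ ∃ i, v = simpleCoord i := by
  obtain ⟨h1, h2, h3, h4⟩ := hv
  have hdl : d ∈ ([1, 2, 3, 6] : List ℤ) := by
    have := Int.le_of_dvd (by norm_num) hd6
    interval_cases d <;> revert hd6 <;> decide
  have hel : e ∈ ([0, 1] : List ℤ) := by simpa using he
  rw [iform, hm, hk] at hnorm
  rw [hm, hk] at hs
  have hF : d * ((7 * m - 6 * k - e) * (7 * m - 6 * k - e) + 112 * (m * k)) ≤ 112 := by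
    -- Cauchy–Schwarz against `(5, 0, 1, 0)`, whose norm in `E₈³` is 28.
    have hcs : (5 * v 0 + 3 * v 2) * (5 * v 0 + 3 * v 2) ≤ 28 * (4 * d - 4 * (d * m) * (d * k)) := by
      nlinarith [mul_self_nonneg (v 0 - 5 * v 2), mul_self_nonneg (v 1), mul_self_nonneg (v 3)]
    rw [show 5 * v 0 + 3 * v 2 = -(d * (7 * m - 6 * k - e)) by linarith] at hcs
    exact le_of_mul_le_mul_left (by linarith) hd
  have hF1 : (7 * m - 6 * k - e) * (7 * m - 6 * k - e) + 112 * (m * k) ≤ 112 := by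
    by_contra! hcon
    nlinarith
  -- Up to the shift by `e`, `hF1` bounds the positive definite form `49m² + 28mk + 36k²`.
  -- Completing the square in `k` bounds `m`, and conversely.
  have hml : m ∈ ([-1, 0, 1] : List ℤ) := by
    have h : 392 * m * m - 168 * e * m ≤ 1008 := by
      nlinarith [mul_self_nonneg (18 * k + 7 * m + 3 * e)]
    have : m ≤ 1 := by rcases he with rfl | rfl <;> nlinarith
    have : -1 ≤ m := by rcases he with rfl | rfl <;> nlinarith
    simp only [List.mem_cons, List.not_mem_nil]
    omega
  have hkl : k ∈ ([-2, -1, 0, 1] : List ℤ) := by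
    have h : 32 * k * k + 16 * e * k ≤ 112 := by
      nlinarith [mul_self_nonneg (7 * m + 2 * k - e)]
    have : k ≤ 1 := by rcases he with rfl | rfl <;> nlinarith
    have : -2 ≤ k := by rcases he with rfl | rfl <;> nlinarith
    simp only [List.mem_cons, List.not_mem_nil]
    omega
  have hN := enumeration_bound d hdl e hel m hml k hkl hF
  have hsq : v 0 * v 0 + v 1 * v 1 + 3 * (v 2 * v 2) + 3 * (v 3 * v 3) =
      4 * d - 4 * (d * m) * (d * k) := by linarith
  have b0 := mul_self_nonneg (v 0)
  have b1 := mul_self_nonneg (v 1)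
  have b2 := mul_self_nonneg (v 2)
  have b3 := mul_self_nonneg (v 3)
  have six : ∀ {x : ℤ}, x * x ≤ 48 →
      x ∈ ([-6, -5, -4, -3, -2, -1, 0, 1, 2, 3, 4, 5, 6] : List ℤ) := by
    intro x hx
    have : x ≤ 6 := by nlinarith
    have : -6 ≤ x := by nlinarith
    simp only [List.mem_cons, List.not_mem_nil]
    omega
  have four : ∀ {x : ℤ}, x * x ≤ 16 → x ∈ ([-4, -3, -2, -1, 0, 1, 2, 3, 4] : List ℤ) := by
    intro x hx
    have : x ≤ 4 := by nlinarith
    have : -4 ≤ x := by nlinarith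
    simp only [List.mem_cons, List.not_mem_nil]
    omega
  obtain ⟨he1, i, hi⟩ := enumeration_check d hdl e hel m hml k hkl hF (v 2) (four (by linarith))
    (v 0) (six (by linarith)) (by linarith) (v 1) (six (by linarith)) h1 (v 3)
    (four (by linarith)) h2 h3 h4 hsq
  refine ⟨he1, i, ?_⟩
  rw [← hi, ← hm, ← hk]
  funext j
  fin_cases j <;> rfl

/-! ### The positive cone -/

/-- The cone of positive norm vectors which contains the negative of the Weyl vector. -/
def posCone : Set Ambient := {x | 0 < formL x x ∧ 0 < x.2.1}

theorem wv_mem_posCone : wv ∈ posCone :=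
  ⟨by rw [formL_wv_wv]; norm_num, by simp [wv, vec]⟩

theorem cauchy_formE83 (x y : Fin 4 → ℝ) :
    (x 0 * y 0 + x 1 * y 1 + 3 * (x 2 * y 2) + 3 * (x 3 * y 3)) ^ 2 ≤
      (x 0 * x 0 + x 1 * x 1 + 3 * (x 2 * x 2) + 3 * (x 3 * x 3)) *
        (y 0 * y 0 + y 1 * y 1 + 3 * (y 2 * y 2) + 3 * (y 3 * y 3)) := by
  nlinarith [sq_nonneg (x 0 * y 1 - x 1 * y 0), sq_nonneg (x 0 * y 2 - x 2 * y 0),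
    sq_nonneg (x 0 * y 3 - x 3 * y 0), sq_nonneg (x 1 * y 2 - x 2 * y 1),
    sq_nonneg (x 1 * y 3 - x 3 * y 1), sq_nonneg (x 2 * y 3 - x 3 * y 2)]

theorem posCone_bounds {x : Ambient} (hx : x ∈ posCone) : 0 < -x.2.2 ∧
    x.1 0 * x.1 0 + x.1 1 * x.1 1 + 3 * (x.1 2 * x.1 2) + 3 * (x.1 3 * x.1 3) <
      x.2.1 * -x.2.2 := by
  obtain ⟨h1, h2⟩ := hx
  rw [formL_apply] at h1
  have h : x.1 0 * x.1 0 + x.1 1 * x.1 1 + 3 * (x.1 2 * x.1 2) + 3 * (x.1 3 * x.1 3) <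
      x.2.1 * -x.2.2 := by linarith
  refine ⟨?_, h⟩
  by_contra! hc
  nlinarith [mul_self_nonneg (x.1 0), mul_self_nonneg (x.1 1), mul_self_nonneg (x.1 2),
    mul_self_nonneg (x.1 3)]

/-- Reverse Cauchy–Schwarz: with `A < ab` and `A' < a'b'`, Cauchy–Schwarz in `E₈³` and the
inequality `(ab' + a'b)² ≥ 4aba'b'` bound the `E₈³` part by the hyperbolic part. -/
theorem formL_pos {x y : Ambient} (hx : x ∈ posCone) (hy : y ∈ posCone) : 0 < formL x y := by
  obtain ⟨hx1, hx2⟩ := posCone_bounds hx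
  obtain ⟨hy1, hy2⟩ := posCone_bounds hy
  have hcs := cauchy_formE83 x.1 y.1
  have ha := hx.2
  have ha' := hy.2
  rw [formL_apply]
  have hA : 0 ≤ x.1 0 * x.1 0 + x.1 1 * x.1 1 + 3 * (x.1 2 * x.1 2) + 3 * (x.1 3 * x.1 3) := by
    nlinarith [mul_self_nonneg (x.1 0), mul_self_nonneg (x.1 1), mul_self_nonneg (x.1 2),
      mul_self_nonneg (x.1 3)]
  have hA' : 0 ≤ y.1 0 * y.1 0 + y.1 1 * y.1 1 + 3 * (y.1 2 * y.1 2) + 3 * (y.1 3 * y.1 3) := by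
    nlinarith [mul_self_nonneg (y.1 0), mul_self_nonneg (y.1 1), mul_self_nonneg (y.1 2),
      mul_self_nonneg (y.1 3)]
  obtain ⟨b, hb⟩ : ∃ b, x.2.2 = -b := ⟨-x.2.2, by ring⟩
  obtain ⟨b', hb'⟩ : ∃ b, y.2.2 = -b := ⟨-y.2.2, by ring⟩
  simp only [hb, hb', neg_neg] at *
  generalize x.1 0 * x.1 0 + x.1 1 * x.1 1 + 3 * (x.1 2 * x.1 2) + 3 * (x.1 3 * x.1 3) = A at *
  generalize y.1 0 * y.1 0 + y.1 1 * y.1 1 + 3 * (y.1 2 * y.1 2) + 3 * (y.1 3 * y.1 3) = A' at *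
  generalize x.1 0 * y.1 0 + x.1 1 * y.1 1 + 3 * (x.1 2 * y.1 2) + 3 * (x.1 3 * y.1 3) = P at *
  generalize x.2.1 = a at *
  generalize y.2.1 = a' at *
  have h1 : A * A' < (a * b) * (a' * b') := by
    have := mul_pos ha' hy1
    nlinarith
  have h2 : 0 < a * b' + a' * b := by positivity
  by_contra! hcon
  have h3 : (a * b' + a' * b) ^ 2 ≤ (2 * P) ^ 2 := by
    apply pow_le_pow_left₀ h2.le
    linarith
  nlinarith [sq_nonneg (a * b' - a' * b)]

theorem mem_or_neg_mem_posCone {x : Ambient} (hx : 0 < formL x x) :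
    x ∈ posCone ∨ -x ∈ posCone := by
  rcases lt_trichotomy x.2.1 0 with h | h | h
  · exact Or.inr ⟨by simpa using hx, by simpa using h⟩
  · exfalso
    rw [formL_apply, h] at hx
    nlinarith [mul_self_nonneg (x.1 0), mul_self_nonneg (x.1 1), mul_self_nonneg (x.1 2),
      mul_self_nonneg (x.1 3)]
  · exact Or.inl ⟨hx, h⟩

theorem mem_posCone_of_formL_pos {x y : Ambient} (hx : x ∈ posCone) (hy : 0 < formL y y)
    (hxy : 0 < formL x y) : y ∈ posCone := by
  rcases mem_or_neg_mem_posCone hy with h | h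
  · exact h
  · have := formL_pos hx h
    rw [map_neg] at this
    linarith

theorem formL_self_nonpos_of_orthogonal {x y : Ambient} (hx : x ∈ posCone) (hxy : formL x y = 0) :
    formL y y ≤ 0 := by
  by_contra! hy
  rcases mem_or_neg_mem_posCone hy with h | h
  · exact (formL_pos hx h).ne' hxy
  · have := formL_pos hx h
    rw [map_neg, hxy, neg_zero] at this
    exact this.false

theorem add_mem_posCone {x y : Ambient} (hx : x ∈ posCone) (hy : y ∈ posCone) :
    x + y ∈ posCone := by
  refine ⟨?_, add_pos hx.2 hy.2⟩
  have h1 := formL_pos hx hy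
  have h2 := formL_pos hy hx
  have h3 := hx.1
  have h4 := hy.1
  simp only [map_add, LinearMap.add_apply]
  linarith

theorem smul_mem_posCone {x : Ambient} (hx : x ∈ posCone) {c : ℝ} (hc : 0 < c) :
    c • x ∈ posCone := by
  refine ⟨?_, mul_pos hc hx.2⟩
  have := hx.1
  simp only [map_smul, LinearMap.smul_apply, smul_eq_mul]
  positivity

theorem refl_mem_posCone {α x : Ambient} (hα : formL α α < 0) (hx : x ∈ posCone) :
    refl α x ∈ posCone := by
  refine mem_posCone_of_formL_pos hx (by rw [formL_refl]; exact hx.1) ?_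
  rw [refl_apply, map_sub, map_smul, smul_eq_mul, formL_comm x α]
  have h1 := hx.1
  have h2 : 2 / formL α α * formL α x * formL α x ≤ 0 := by
    rw [mul_assoc]
    exact mul_nonpos_of_nonpos_of_nonneg (div_nonpos_of_nonneg_of_nonpos (by norm_num) hα.le)
      (mul_self_nonneg _)
  linarith

/-! ### Roots and the simple reflections -/

theorem formL_sroot_self (i : Fin 8) : formL (sroot i) (sroot i) = -2 * sd i := by
  rw [formL_sroot, gram_self]; push_cast; ring

theorem refl_sroot_apply (i : Fin 8) (x : Ambient) :
    refl (sroot i) x = x + (formL x (sroot i) / sd i) • sroot i := by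
  have : (sd i : ℝ) ≠ 0 := by exact_mod_cast (sd_pos i).ne'
  rw [refl_apply, formL_sroot_self, sub_eq_add_neg, ← neg_smul, formL_comm]
  congr 2
  field_simp

/-- This is where the Weyl vector property enters: the factor `1 / sd i` of the reflection cancels
against the height `sd i` of the simple root. -/
theorem formL_wv_refl (i : Fin 8) (x : Ambient) :
    formL wv (refl (sroot i) x) = formL wv x + formL x (sroot i) := by
  have : (sd i : ℝ) ≠ 0 := by exact_mod_cast (sd_pos i).ne'
  rw [refl_sroot_apply, map_add, map_smul, formL_wv_sroot, smul_eq_mul]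
  field_simp

/-- Inner products with a root are divisible by half its norm. -/
theorem IsRoot.exists_halfNorm {β : Ambient} (h : IsRoot formL latticeL β) :
    ∃ d : ℤ, 0 < d ∧ formL β β = -2 * d ∧ (∀ x ∈ latticeL, ∃ z : ℤ, formL x β = d * z) ∧
      formL wv β ≠ 0 ∧ (formL wv β = d → ∃ i, β = sroot i) := by
  obtain ⟨v, d, hv, rfl, hd, hd6, hnorm, hdvd⟩ := h.exists_coord
  obtain ⟨z5, h5⟩ := hdvd ![0, 0, 0, 0, 1, 0] (by unfold InL; decide)
  obtain ⟨z6, h6⟩ := hdvd ![0, 0, 0, 0, 0, 1] (by unfold InL; decide)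
  simp only [iform, Matrix.cons_val] at h5 h6
  have hw : formL wv (vec v) = (5 * v 0 + 3 * v 2 + 7 * v 4 - 6 * v 5 : ℤ) := by
    rw [wv, formL_vec, iform]
    simp only [Matrix.cons_val]
    push_cast
    ring
  refine ⟨d, hd, ?_, fun x hx => ?_, fun h0 => ?_, fun h1 => ?_⟩
  · rw [formL_vec, hnorm]; push_cast; ring
  · obtain ⟨u, hu, rfl⟩ := (mem_latticeL_iff _).1 hx
    obtain ⟨z, hz⟩ := hdvd u hu
    refine ⟨-z, ?_⟩
    rw [formL_comm, formL_vec, hz]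
    push_cast
    ring
  · rw [hw] at h0
    have := enumeration (m := z6) (k := z5) (e := 0) hv hd hd6 hnorm (by linarith) (by linarith)
      (Or.inl rfl) (by rw [mul_zero]; exact_mod_cast h0)
    simp at this
  · rw [hw] at h1
    obtain ⟨-, i, hi⟩ := enumeration (m := z6) (k := z5) (e := 1) hv hd hd6 hnorm (by linarith)
      (by linarith) (Or.inr rfl) (by rw [mul_one]; exact_mod_cast h1)
    exact ⟨i, congrArg vec hi⟩

/-- The determinant of the Gram matrix of `wv`, a simple root and any vector is nonnegative. -/
theorem gram_det_nonneg (i : Fin 8) (β : Ambient) :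
    28 * formL β (sroot i) ^ 2 + 2 * sd i * formL wv β * (-formL β (sroot i) - formL wv β) ≤
      -formL β β * (56 * sd i + sd i ^ 2) := by
  have hd : (0 : ℝ) < sd i := by exact_mod_cast sd_pos i
  have h1 := formL_wv_sroot i
  have h2 := formL_sroot_self i
  have h3 := formL_wv_wv
  set s := formL wv β with hs
  set a := formL β (sroot i) with ha
  set D : ℝ := 56 * sd i + sd i ^ 2
  have h1' : formL (sroot i) wv = sd i := by rw [formL_comm, h1]
  have hs' : formL β wv = s := by rw [formL_comm]
  have ha' : formL (sroot i) β = a := by rw [formL_comm]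
  -- The vector is `D` times the projection of `β` to the orthogonal complement of `wv` and the
  -- simple root, where `-D` is the Gram determinant of these two. Its norm is nonpositive, and
  -- carries a factor `D`.
  have key := formL_self_nonpos_of_orthogonal (x := wv)
    (y := D • β - (2 * s * sd i + a * sd i) • wv + (28 * a - s * sd i) • sroot i) wv_mem_posCone
    (by
      simp only [map_add, map_sub, map_smul, smul_eq_mul, h1, h3, ← hs]
      ring)
  simp only [map_add, map_sub, map_smul, smul_eq_mul, LinearMap.add_apply, LinearMap.sub_apply,
    LinearMap.smul_apply, h1, h2, h3, h1', hs', ha', ← hs, ← ha] at key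
  have hD : 0 < D := by positivity
  refine le_of_mul_le_mul_left ?_ hD
  simp only [D] at key ⊢
  nlinarith [key]

/-- A simple reflection changes the sign of the height of a root only for the simple root. -/
theorem eq_sroot_of_sign_change {β : Ambient} (hβ : IsRoot formL latticeL β) {i : Fin 8}
    (hpos : 0 < formL wv β) (hneg : formL wv (refl (sroot i) β) ≤ 0) : β = sroot i := by
  have hβ' : IsRoot formL latticeL (refl (sroot i) β) := hβ.map (isRoot_sroot i).refl_mem
  obtain ⟨d, hd, hnorm, hdvd, -, hsimple⟩ := hβ.exists_halfNorm
  obtain ⟨d', hd', hnorm', hdvd', hne', hsimple'⟩ := hβ'.neg.exists_halfNorm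
  have hdd : d' = d := by
    simp only [map_neg, LinearMap.neg_apply, neg_neg, formL_refl] at hnorm'
    have : (d' : ℝ) = d := by linarith
    exact_mod_cast this
  subst hdd
  obtain ⟨S, hS⟩ := hdvd wv (vec_mem wv_inL)
  obtain ⟨T, hT⟩ := hdvd' wv (vec_mem wv_inL)
  have hsum : formL β (sroot i) = -(d' * (S + T)) := by
    have := formL_wv_refl i β
    rw [map_neg] at hT
    linarith
  have hdR : (0 : ℝ) < d' := by exact_mod_cast hd
  have hS0 : 0 < S := by
    rw [hS] at hpos
    exact_mod_cast pos_of_mul_pos_right hpos hdR.le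
  have hT0 : 0 < T := by
    have h : 0 < formL wv (-(refl (sroot i) β)) := by
      refine lt_of_le_of_ne ?_ hne'.symm
      rw [map_neg]; linarith
    rw [hT] at h
    exact_mod_cast pos_of_mul_pos_right h hdR.le
  have hSR : (0 : ℝ) < S := by exact_mod_cast hS0
  have hTR : (0 : ℝ) < T := by exact_mod_cast hT0
  have hneg : formL β (sroot i) < 0 := by
    rw [hsum]
    have := mul_pos hdR (add_pos hSR hTR)
    linarith
  -- `d' * S` and `d' * T` are the heights of `β` and of minus its reflection. If `S` or `T` is 1,
  -- that vector is a simple root, and distinct simple roots have nonnegative inner product.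
  rcases (show S = 1 ∨ T = 1 ∨ (2 ≤ S ∧ 2 ≤ T) by omega) with h | h | ⟨h2S, h2T⟩
  · obtain ⟨j, rfl⟩ := hsimple (by rw [hS, h]; simp)
    rw [formL_sroot] at hneg
    by_contra hij
    have := gram_nonneg (i := j) (j := i) (fun h => hij (congrArg sroot h))
    have : (0 : ℝ) ≤ gram j i := by exact_mod_cast this
    linarith
  · obtain ⟨j, hj⟩ := hsimple' (by rw [hT, h]; simp)
    have hj' : formL (sroot j) (sroot i) < 0 := by
      have h1 := formL_refl (sroot i) β (sroot i)
      rw [refl_self (isRoot_sroot i).2.1.ne, map_neg] at h1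
      rw [← hj, map_neg, LinearMap.neg_apply]
      linarith
    have hij : j = i := by
      by_contra hij
      rw [formL_sroot] at hj'
      have : (0 : ℝ) ≤ gram j i := by exact_mod_cast gram_nonneg hij
      linarith
    rw [hij] at hj
    rw [← refl_refl (sroot i) β, neg_eq_iff_eq_neg.1 hj, map_neg,
      refl_self (isRoot_sroot i).2.1.ne, neg_neg]
  · exfalso
    obtain ⟨K, hK⟩ : ∃ K : ℤ, d' * (S + T) = sd i * K := by
      obtain ⟨v, hv, rfl⟩ := (mem_latticeL_iff _).1 hβ.1.1
      obtain ⟨z, hz⟩ := sroot_dvd i hv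
      refine ⟨z, ?_⟩
      rw [formL_comm, sroot, formL_vec, hz] at hsum
      have : (d' * (S + T) : ℝ) = sd i * z := by push_cast at hsum; linarith
      exact_mod_cast this
    have hdet := gram_det_nonneg i β
    rw [hsum, hS, hnorm] at hdet
    have hdet' : 28 * (-(d' * (S + T))) ^ 2 + 2 * sd i * (d' * S) * (d' * T) ≤
        2 * d' * (56 * sd i + sd i ^ 2) := by
      have : (28 * (-(d' * (S + T))) ^ 2 + 2 * sd i * (d' * S) * (d' * T) : ℝ) ≤
        2 * d' * (56 * sd i + sd i ^ 2) := by linarith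
      exact_mod_cast this
    have hsd := sd_pos i
    have hsd6 := sd_le i
    have hsd4 : ∀ i, sd i ≠ 4 := by decide
    have h4 := hsd4 i
    generalize sd i = c at *
    -- The determinant inequality divided by `2 * d' * c`. As `S, T ≥ 2` and `c ≤ 6`, it forces `S +
    -- T = 4` and `K = 1`, so `c = 4 * d' = 4`, which is not half the norm of a simple root up to
    -- sign.
    have hred : 14 * ((S + T) * K) + d' * (S * T) ≤ 56 + c := by
      have : 2 * d' * c * (14 * ((S + T) * K) + d' * (S * T)) ≤ 2 * d' * c * (56 + c) := by
        have e : d' * (S + T) * (d' * (S + T)) = d' * (S + T) * (c * K) := by rw [← hK]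
        linarith
      exact le_of_mul_le_mul_left this (by positivity)
    have hK0 : 0 < K := by
      have : 0 < c * K := by rw [← hK]; positivity
      exact pos_of_mul_pos_right this hsd.le
    have hST : 4 ≤ S * T := by nlinarith
    have hU : (S + T) * K ≤ 4 := by nlinarith
    have hK1 : K = 1 := by nlinarith
    subst hK1
    have hU4 : S + T = 4 := by linarith
    have hd1 : d' = 1 := by
      rw [hU4] at hK
      omega
    subst hd1
    omega

/-! ### Positive roots and generation by simple reflections -/

/-- The group generated by the simple reflections. -/
noncomputable def simpleGroup : Subgroup (Ambient ≃ₗ[ℝ] Ambient) :=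
  Subgroup.closure (Set.range fun i => refl (sroot i))

theorem refl_sroot_mem (i : Fin 8) : refl (sroot i) ∈ simpleGroup :=
  Subgroup.subset_closure ⟨i, rfl⟩

theorem simpleGroup_le : simpleGroup ≤ autGroup formL latticeL := by
  rw [simpleGroup, Subgroup.closure_le]
  rintro _ ⟨i, rfl⟩
  exact (isRoot_sroot i).refl_mem

/-- Every positive root is a nonnegative combination of simple roots, and conjugate to a simple
root under the simple reflections. -/
theorem IsRoot.positive {β : Ambient} (hβ : IsRoot formL latticeL β) (hpos : 0 < formL wv β) :
    (∃ c : Fin 8 → ℝ, (∀ j, 0 ≤ c j) ∧ β = ∑ j, c j • sroot j) ∧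
      ∃ g ∈ simpleGroup, ∃ j, β = g (sroot j) := by
  obtain ⟨N, hN⟩ := exists_nat_ge (formL wv β)
  induction N generalizing β with
  | zero => exact absurd hN (by push_cast; exact not_le.2 hpos)
  | succ N ih =>
    obtain ⟨i, hi⟩ : ∃ i, formL β (sroot i) < 0 := by
      by_contra! h
      exact absurd (formL_self_nonneg h) (not_le.2 hβ.2.1)
    rcases le_or_gt (formL wv (refl (sroot i) β)) 0 with hneg | hpos'
    · obtain rfl := eq_sroot_of_sign_change hβ hpos hneg
      refine ⟨⟨Pi.single i 1, fun j => ?_, ?_⟩, 1, one_mem _, i, rfl⟩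
      · by_cases h : j = i
        · subst h; simp
        · simp [h]
      · rw [Finset.sum_eq_single i (fun j _ h => by simp [h]) (by simp)]
        simp
    -- Integrality makes the height drop by at least 1, so the induction on its bound `N`
    -- terminates.
    · have hle : formL β (sroot i) ≤ -1 := by
        obtain ⟨d, -, -, hd, -⟩ := (isRoot_sroot i).exists_halfNorm
        obtain ⟨z, hz⟩ := hd β hβ.1.1
        rw [hz] at hi ⊢
        have hi' : d * z < 0 := by exact_mod_cast hi
        exact_mod_cast (show d * z ≤ -1 by omega)
      obtain ⟨⟨c, hc, hsum⟩, g, hg, j, hgj⟩ := ih (hβ.map (isRoot_sroot i).refl_mem) hpos' (by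
        rw [formL_wv_refl]
        push_cast at hN
        linarith)
      constructor
      · refine ⟨c + Pi.single i (-formL β (sroot i) / sd i), fun k => add_nonneg (hc k) ?_, ?_⟩
        · have : (0 : ℝ) < sd i := by exact_mod_cast sd_pos i
          by_cases h : k = i
          · subst h
            rw [Pi.single_eq_same]
            exact div_nonneg (by linarith) this.le
          · simp [h]
        · simp only [Pi.add_apply, add_smul, Finset.sum_add_distrib, ← hsum]
          rw [Finset.sum_eq_single i (fun j _ h => by simp [h]) (by simp), Pi.single_eq_same,
            refl_sroot_apply, add_assoc, ← add_smul, neg_div, add_neg_cancel, zero_smul, add_zero]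
      · refine ⟨refl (sroot i) * g, mul_mem (refl_sroot_mem i) hg, j, ?_⟩
        rw [LinearEquiv.mul_apply, ← hgj, refl_refl]

theorem IsRoot.refl_mem_simpleGroup {β : Ambient} (hβ : IsRoot formL latticeL β) :
    refl β ∈ simpleGroup := by
  have key : ∀ {β}, IsRoot formL latticeL β → 0 < formL wv β → refl β ∈ simpleGroup := by
    intro β hβ hpos
    obtain ⟨-, g, hg, j, rfl⟩ := hβ.positive hpos
    rw [refl_map (simpleGroup_le hg)]
    exact mul_mem (mul_mem hg (refl_sroot_mem j)) (inv_mem hg)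
  obtain ⟨-, -, -, -, hne, -⟩ := hβ.exists_halfNorm
  rcases hne.lt_or_gt with h | h
  · rw [← refl_neg]
    exact key hβ.neg (by rw [map_neg]; linarith)
  · exact key hβ h

theorem reflectionGroup_eq : reflectionGroup formL latticeL = simpleGroup := by
  apply le_antisymm
  · rw [reflectionGroup, Subgroup.closure_le]
    rintro g ⟨α, hα, hg⟩
    rw [eq_refl_of_coe hg]
    exact hα.refl_mem_simpleGroup
  · rw [simpleGroup, Subgroup.closure_le]
    rintro _ ⟨i, rfl⟩
    exact Subgroup.subset_closure ⟨sroot i, isRoot_sroot i, rfl⟩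

/-! ### The action on the Weyl vector is free -/

/-- The product of a word in the simple reflections. -/
noncomputable def wordProd (l : List (Fin 8)) : Ambient ≃ₗ[ℝ] Ambient :=
  (l.map fun i => refl (sroot i)).prod

theorem wordProd_mem (l : List (Fin 8)) : wordProd l ∈ simpleGroup := by
  apply Subgroup.list_prod_mem
  intro g hg
  obtain ⟨i, -, rfl⟩ := List.mem_map.1 hg
  exact refl_sroot_mem i

theorem exists_wordProd_eq {g : Ambient ≃ₗ[ℝ] Ambient} (hg : g ∈ simpleGroup) :
    ∃ l, wordProd l = g := by
  induction hg using Subgroup.closure_induction with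
  | mem g hg =>
    obtain ⟨i, rfl⟩ := hg
    exact ⟨[i], by simp [wordProd]⟩
  | one => exact ⟨[], rfl⟩
  | mul g h _ _ hg hh =>
    obtain ⟨l, rfl⟩ := hg
    obtain ⟨l', rfl⟩ := hh
    exact ⟨l ++ l', by simp [wordProd]⟩
  | inv g hg ih =>
    obtain ⟨l, rfl⟩ := ih
    refine ⟨l.reverse, ?_⟩
    simp [wordProd, List.prod_inv_reverse, List.map_map, Function.comp_def, refl_inv]

theorem map_mem_posCone {g : Ambient ≃ₗ[ℝ] Ambient} (hg : g ∈ simpleGroup) {x : Ambient}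
    (hx : x ∈ posCone) : g x ∈ posCone := by
  obtain ⟨l, rfl⟩ := exists_wordProd_eq hg
  induction l with
  | nil => exact hx
  | cons i l ih =>
    rw [show wordProd (i :: l) = refl (sroot i) * wordProd l by simp [wordProd]]
    exact refl_mem_posCone (isRoot_sroot i).2.1 (ih (wordProd_mem l))

/-- The exchange property. -/
theorem exchange (l : List (Fin 8)) (k : Fin 8) (h : formL wv (wordProd l (sroot k)) < 0) :
    ∃ l', l'.length + 1 = l.length ∧ wordProd l * refl (sroot k) = wordProd l' := by
  induction l with
  | nil =>
    have : (0 : ℝ) < sd k := by exact_mod_cast sd_pos k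
    have h' : formL wv (sroot k) < 0 := h
    rw [formL_wv_sroot] at h'
    linarith
  | cons i l ih =>
    have hcons : wordProd (i :: l) = refl (sroot i) * wordProd l := by simp [wordProd]
    have hroot : IsRoot formL latticeL (wordProd l (sroot k)) :=
      (isRoot_sroot k).map (simpleGroup_le (wordProd_mem l))
    rcases lt_or_ge (formL wv (wordProd l (sroot k))) 0 with hl | hl
    · obtain ⟨l', hlen, hl'⟩ := ih hl
      refine ⟨i :: l', by simp [hlen], ?_⟩
      rw [hcons, mul_assoc, hl']
      simp [wordProd]
    · obtain ⟨-, -, -, -, hne, -⟩ := hroot.exists_halfNorm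
      have heq := eq_sroot_of_sign_change (i := i) hroot (lt_of_le_of_ne hl hne.symm)
        (by rw [hcons] at h; exact h.le)
      refine ⟨l, rfl, ?_⟩
      rw [hcons, ← heq, refl_map (simpleGroup_le (wordProd_mem l))]
      simp only [mul_assoc, inv_mul_cancel_left, refl_mul_refl, mul_one]

/-- An element of the simple reflection group which fixes the Weyl vector is trivial. -/
theorem eq_one_of_map_wv {g : Ambient ≃ₗ[ℝ] Ambient} (hg : g ∈ simpleGroup) (h : g wv = wv) :
    g = 1 := by
  obtain ⟨l, rfl⟩ := exists_wordProd_eq hg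
  clear hg
  induction hn : l.length using Nat.strong_induction_on generalizing l with
  | _ n ih =>
    rcases List.eq_nil_or_concat l with rfl | ⟨l0, k, rfl⟩
    · rfl
    · rw [List.concat_eq_append] at *
      have hprod : wordProd (l0 ++ [k]) = wordProd l0 * refl (sroot k) := by simp [wordProd]
      have hk : (0 : ℝ) < sd k := by exact_mod_cast sd_pos k
      have h1 : formL wv (wordProd (l0 ++ [k]) (sroot k)) = sd k := by
        have := formL_map (simpleGroup_le (wordProd_mem (l0 ++ [k]))) wv (sroot k)
        rwa [h, formL_wv_sroot] at this
      -- An isometry fixing `wv` preserves heights, so `wordProd l0` sends the simple root `k` to a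
      -- negative root. The exchange property then shortens the word by two letters.
      rw [hprod, LinearEquiv.mul_apply, refl_self (isRoot_sroot k).2.1.ne, map_neg, map_neg] at h1
      obtain ⟨l', hlen, hl'⟩ := exchange l0 k (by linarith)
      rw [hprod, hl'] at h ⊢
      exact ih l'.length (by rw [← hn]; simp; omega) l' h rfl

/-! ### Descent to the fundamental chamber -/

/-- Since `x - δu` lies in the cone for `u = (0, (1, -1))`, a bound on `(x, y)` bounds `(u, y)` for
all `y` in the cone, which gives the finiteness below. -/
theorem exists_sub_mem_posCone {x : Ambient} (hx : x ∈ posCone) :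
    ∃ δ : ℝ, 0 < δ ∧ x - δ • ((0, (1, -1)) : Ambient) ∈ posCone := by
  obtain ⟨hb, hab⟩ := posCone_bounds hx
  have ha := hx.2
  set A := x.1 0 * x.1 0 + x.1 1 * x.1 1 + 3 * (x.1 2 * x.1 2) + 3 * (x.1 3 * x.1 3) with hA
  have hA0 : 0 ≤ A := by
    rw [hA]
    nlinarith [mul_self_nonneg (x.1 0), mul_self_nonneg (x.1 1), mul_self_nonneg (x.1 2),
      mul_self_nonneg (x.1 3)]
  have hsum : 0 < x.2.1 + -x.2.2 := add_pos ha hb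
  -- With this choice the linear terms cancel and `x - δu` has norm `2δ²`.
  obtain ⟨δ, hδ⟩ : ∃ δ, δ = (x.2.1 * -x.2.2 - A) / (x.2.1 + -x.2.2) := ⟨_, rfl⟩
  have hδ0 : 0 < δ := by rw [hδ]; exact div_pos (by linarith) hsum
  have hδ1 : δ * (x.2.1 + -x.2.2) = x.2.1 * -x.2.2 - A := by
    rw [hδ]; exact div_mul_cancel₀ _ hsum.ne'
  refine ⟨δ, hδ0, ?_, ?_⟩
  · rw [formL_apply]
    simp only [Prod.fst_sub, Prod.snd_sub, Prod.smul_fst, Prod.smul_snd, smul_zero, sub_zero,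
      smul_eq_mul]
    nlinarith [mul_pos hδ0 hδ0]
  · simp only [Prod.fst_sub, Prod.snd_sub, Prod.smul_fst, Prod.smul_snd, smul_eq_mul]
    nlinarith [mul_pos ha ha]

theorem finite_lattice_le {x : Ambient} (hx : x ∈ posCone) (K : ℝ) :
    {y | y ∈ latticeL ∧ y ∈ posCone ∧ formL x y ≤ K}.Finite := by
  obtain ⟨δ, hδ, hmem⟩ := exists_sub_mem_posCone hx
  -- The factor 2 compensates for the halves in the coordinates of `vec`.
  obtain ⟨N, hN⟩ := exists_nat_ge (2 * (K / δ))
  refine ((Set.finite_Icc (fun _ : Fin 6 => -(N : ℤ)) (fun _ => (N : ℤ))).image vec).subset ?_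
  rintro y ⟨hyL, hy, hyK⟩
  obtain ⟨v, -, rfl⟩ := (mem_latticeL_iff y).1 hyL
  refine ⟨v, ?_, rfl⟩
  have h1 := formL_pos hmem hy
  obtain ⟨hb', hab'⟩ := posCone_bounds hy
  have ha' := hy.2
  rw [map_sub, map_smul, LinearMap.sub_apply, LinearMap.smul_apply, smul_eq_mul,
    formL_apply (0, (1, -1))] at h1
  simp only [vec, Matrix.cons_val, Pi.zero_apply, zero_mul, mul_zero, add_zero] at h1 hb' hab' ha'
  have h2 : (v 4 : ℝ) + -v 5 ≤ N / 2 := by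
    have : (v 4 : ℝ) + -v 5 ≤ K / δ := by
      rw [le_div_iff₀ hδ]
      have : formL x (vec v) ≤ K := hyK
      simp only [vec] at this
      linarith
    linarith
  have hN0 : (0 : ℝ) ≤ N := N.cast_nonneg
  have h3 : (v 4 : ℝ) * -v 5 ≤ (N / 2) * (N / 2) := by
    apply mul_le_mul <;> linarith
  have h4 : ∀ i, (v i : ℝ) * v i ≤ N * N := by
    have b0 := mul_self_nonneg (v 0 : ℝ)
    have b1 := mul_self_nonneg (v 1 : ℝ)
    have b2 := mul_self_nonneg (v 2 : ℝ)
    have b3 := mul_self_nonneg (v 3 : ℝ)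
    intro i
    fin_cases i <;> simp only [Fin.zero_eta, Fin.mk_one, Fin.reduceFinMk] <;> nlinarith
  rw [Set.mem_Icc, Pi.le_def, Pi.le_def, ← forall_and]
  intro i
  have h5 := abs_le_of_sq_le_sq' (a := (v i : ℝ)) (b := N) (by nlinarith [h4 i]) hN0
  exact ⟨by exact_mod_cast h5.1, by exact_mod_cast h5.2⟩

/-- Every vector of the positive cone can be moved into the fundamental chamber. -/
theorem exists_map_nonneg {x : Ambient} (hx : x ∈ posCone) :
    ∃ g ∈ simpleGroup, ∀ i, 0 ≤ formL (sroot i) (g x) := by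
  set S : Set Ambient := {y | (∃ g ∈ simpleGroup, y = g wv) ∧ formL x y ≤ formL x wv} with hS
  have hfin : S.Finite := by
    refine (finite_lattice_le hx (formL x wv)).subset ?_
    rintro y ⟨⟨g, hg, rfl⟩, hy⟩
    exact ⟨(map_mem_iff (simpleGroup_le hg) wv).2 (vec_mem wv_inL),
      map_mem_posCone hg wv_mem_posCone, hy⟩
  obtain ⟨y, ⟨⟨g, hg, rfl⟩, hle⟩, hmin⟩ :=
    Set.exists_min_image S (formL x) hfin ⟨wv, ⟨1, one_mem _, rfl⟩, le_rfl⟩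
  refine ⟨g⁻¹, inv_mem hg, fun i => ?_⟩
  -- Since `refl (sroot i) wv = wv + sroot i`, minimality at `g wv` says exactly that `g⁻¹ x` pairs
  -- nonnegatively with `sroot i`. If the competitor lies outside `S`, it is no smaller anyway.
  have h1 : formL x (g wv) ≤ formL x ((g * refl (sroot i)) wv) := by
    rcases le_total (formL x ((g * refl (sroot i)) wv)) (formL x wv) with h | h
    · exact hmin _ ⟨⟨_, mul_mem hg (refl_sroot_mem i), rfl⟩, h⟩
    · exact hle.trans h
  have hgx : g (g⁻¹ x) = x := g.apply_symm_apply x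
  have hsd : (sd i : ℝ) ≠ 0 := by exact_mod_cast (sd_pos i).ne'
  have h2 : ∀ y, formL x (g y) = formL (g⁻¹ x) y := fun y => by
    rw [← formL_map (simpleGroup_le hg) (g⁻¹ x), hgx]
  rw [LinearEquiv.mul_apply, h2, h2, refl_sroot_apply, formL_wv_sroot, div_self hsd, one_smul,
    map_add] at h1
  rw [formL_comm]
  linarith

/-! ### Topology of the positive cones -/

theorem continuous_formL (x : Ambient) : Continuous fun y => formL x y := by
  simp only [formL_apply]
  fun_prop

theorem continuous_formL_self : Continuous fun y => formL y y := by
  simp only [formL_apply]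
  fun_prop

theorem pos_of_isPreconnected {X : Type*} [TopologicalSpace X] {s : Set X} (hs : IsPreconnected s)
    {f : X → ℝ} (hf : ContinuousOn f s) (h0 : ∀ x ∈ s, f x ≠ 0) {x y : X} (hx : x ∈ s)
    (hy : y ∈ s) (hfx : 0 < f x) : 0 < f y := by
  by_contra! h
  obtain ⟨z, hz, hfz⟩ := hs.intermediate_value hy hx hf ⟨h, hfx.le⟩
  exact h0 z hz hfz

theorem isOpen_posCone : IsOpen posCone :=
  (isOpen_lt continuous_const continuous_formL_self).inter
    (isOpen_lt continuous_const (continuous_fst.comp continuous_snd))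

theorem convex_posCone : Convex ℝ posCone := by
  intro x hx y hy a b ha hb hab
  rcases ha.eq_or_lt with rfl | ha
  · obtain rfl : b = 1 := by linarith
    simpa using hy
  rcases hb.eq_or_lt with rfl | hb
  · obtain rfl : a = 1 := by linarith
    simpa using hx
  exact add_mem_posCone (smul_mem_posCone hx ha) (smul_mem_posCone hy hb)

/-- The coordinate `x.2.1` does not vanish on vectors of positive norm, so it keeps its sign on a
component. Conversely `posCone` is convex. -/
theorem connectedComponentIn_posCone {x : Ambient} (hx : x ∈ posCone) :
    connectedComponentIn {y | 0 < formL y y} x = posCone := by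
  apply Set.Subset.antisymm
  · intro y hy
    refine ⟨connectedComponentIn_subset {y : Ambient | 0 < formL y y} _ hy, ?_⟩
    refine pos_of_isPreconnected (isPreconnected_connectedComponentIn)
      (f := fun z : Ambient => z.2.1) (by fun_prop) (fun z hz h0 => ?_)
      (mem_connectedComponentIn hx.1) hy hx.2
    rcases mem_or_neg_mem_posCone
      (connectedComponentIn_subset {y : Ambient | 0 < formL y y} _ hz) with h | h
    · exact h.2.ne' h0
    · exact h.2.ne' (by simpa using h0)
  · exact convex_posCone.isPreconnected.subset_connectedComponentIn hx fun y hy => hy.1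

/-- The homeomorphism underlying a linear equivalence. -/
noncomputable def homeo (g : Ambient ≃ₗ[ℝ] Ambient) : Ambient ≃ₜ Ambient :=
  g.toContinuousLinearEquiv.toHomeomorph

theorem image_connectedComponentIn (g : Ambient ≃ₗ[ℝ] Ambient) {F : Set Ambient} {x : Ambient}
    (hx : x ∈ F) : g '' connectedComponentIn F x = connectedComponentIn (g '' F) (g x) :=
  (homeo g).image_connectedComponentIn hx

theorem image_closure (g : Ambient ≃ₗ[ℝ] Ambient) (F : Set Ambient) :
    g '' closure F = closure (g '' F) :=
  (homeo g).image_closure F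

theorem inv_image_image (g : Ambient ≃ₗ[ℝ] Ambient) (F : Set Ambient) :
    (g⁻¹ : Ambient ≃ₗ[ℝ] Ambient) '' (g '' F) = F := by
  rw [Set.image_image]
  simp_rw [show ∀ x, (g⁻¹ : Ambient ≃ₗ[ℝ] Ambient) (g x) = x from g.symm_apply_apply]
  exact Set.image_id F

theorem image_mul (g h : Ambient ≃ₗ[ℝ] Ambient) (F : Set Ambient) :
    (g * h : Ambient ≃ₗ[ℝ] Ambient) '' F = g '' (h '' F) := by
  rw [Set.image_image]
  rfl

theorem isPositiveCone_posCone : IsPositiveCone formL posCone :=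
  ⟨wv, wv_mem_posCone.1, (connectedComponentIn_posCone wv_mem_posCone).symm⟩

theorem IsPositiveCone.eq_or_neg {C : Set Ambient} (hC : IsPositiveCone formL C) :
    C = posCone ∨ (LinearEquiv.neg ℝ : Ambient ≃ₗ[ℝ] Ambient) '' C = posCone := by
  obtain ⟨x, hx, rfl⟩ := hC
  rcases mem_or_neg_mem_posCone hx with h | h
  · exact Or.inl (connectedComponentIn_posCone h)
  · right
    rw [image_connectedComponentIn _ hx, ← connectedComponentIn_posCone h]
    congr 1
    ext y
    simp

/-- An isometry which maps one vector of the positive cone into it preserves all positive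
cones. -/
theorem mem_autPlus {g : Ambient ≃ₗ[ℝ] Ambient} (hg : g ∈ autGroup formL latticeL) {x : Ambient}
    (hx : x ∈ posCone) (hgx : g x ∈ posCone) : g ∈ autPlus formL latticeL := by
  have himage : g '' {y | 0 < formL y y} = {y | 0 < formL y y} := by
    ext y
    constructor
    · rintro ⟨z, hz, rfl⟩
      simpa [formL_map hg] using hz
    · intro hy
      have hgy : g (g⁻¹ y) = y := g.apply_symm_apply y
      refine ⟨g⁻¹ y, ?_, hgy⟩
      change 0 < formL (g⁻¹ y) (g⁻¹ y)
      rw [← formL_map hg, hgy]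
      exact hy
  have hpos : g '' posCone = posCone := by
    rw [← connectedComponentIn_posCone hx, image_connectedComponentIn _ hx.1, himage,
      connectedComponentIn_posCone hx, connectedComponentIn_posCone hgx]
  refine ⟨hg, fun C hC => ?_⟩
  rcases hC.eq_or_neg with rfl | h
  · exact hpos
  · have h' : C = (LinearEquiv.neg ℝ : Ambient ≃ₗ[ℝ] Ambient) '' posCone := by
      rw [← h, Set.image_image]
      simp
    rw [h', Set.image_image]
    conv_rhs => rw [← hpos, Set.image_image]
    simp

theorem image_posCone {g : Ambient ≃ₗ[ℝ] Ambient} (hg : g ∈ autPlus formL latticeL) :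
    g '' posCone = posCone := hg.2 _ isPositiveCone_posCone

theorem simpleGroup_le_autPlus : simpleGroup ≤ autPlus formL latticeL := fun _ hg =>
  mem_autPlus (simpleGroup_le hg) wv_mem_posCone (map_mem_posCone hg wv_mem_posCone)

/-! ### The fundamental chamber -/

/-- The points of hyperbolic space on no reflection hyperplane. -/
def regularSet (C : Set Ambient) : Set Ambient :=
  {y | y ∈ hyperbolicSpace formL C ∧ ∀ α, IsRoot formL latticeL α → formL α y ≠ 0}

theorem image_regularSet {g : Ambient ≃ₗ[ℝ] Ambient} (hg : g ∈ autGroup formL latticeL)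
    (C : Set Ambient) : g '' regularSet C = regularSet (g '' C) := by
  ext y
  constructor
  · rintro ⟨x, ⟨⟨hxC, hx1⟩, hx⟩, rfl⟩
    refine ⟨⟨⟨x, hxC, rfl⟩, by rw [formL_map hg, hx1]⟩, fun α hα => ?_⟩
    have hgα : g (g⁻¹ α) = α := g.apply_symm_apply α
    rw [← hgα, formL_map hg]
    exact hx _ (hα.map (inv_mem hg))
  · rintro ⟨⟨⟨x, hxC, rfl⟩, hx1⟩, hx⟩
    refine ⟨x, ⟨⟨hxC, by rwa [formL_map hg] at hx1⟩, fun α hα => ?_⟩, rfl⟩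
    rw [← formL_map hg]
    exact hx _ (hα.map hg)

/-- The interior of the fundamental chamber. -/
def openChamber : Set Ambient :=
  {x | x ∈ posCone ∧ formL x x = 1 ∧ ∀ i, 0 < formL (sroot i) x}

/-- The fundamental chamber. -/
def closedChamber : Set Ambient :=
  {x | x ∈ posCone ∧ formL x x = 1 ∧ ∀ i, 0 ≤ formL (sroot i) x}

theorem IsRoot.ne_zero {α : Ambient} (hα : IsRoot formL latticeL α) : α ≠ 0 := by
  rintro rfl
  simpa using hα.2.1

theorem IsRoot.formL_pos {α : Ambient} (hα : IsRoot formL latticeL α) (hpos : 0 < formL wv α)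
    {x : Ambient} (hx : ∀ i, 0 < formL (sroot i) x) : 0 < formL α x := by
  obtain ⟨⟨c, hc, hsum⟩, -⟩ := hα.positive hpos
  obtain ⟨j, hj⟩ : ∃ j, c j ≠ 0 := by
    by_contra! h
    exact hα.ne_zero (by rw [hsum]; simp [h])
  rw [hsum, map_sum, LinearMap.sum_apply]
  simp only [map_smul, LinearMap.smul_apply, smul_eq_mul]
  exact Finset.sum_pos' (fun i _ => mul_nonneg (hc i) (hx i).le)
    ⟨j, Finset.mem_univ _, mul_pos ((hc j).lt_of_ne' hj) (hx j)⟩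

theorem IsRoot.formL_ne_zero {α : Ambient} (hα : IsRoot formL latticeL α)
    {x : Ambient} (hx : ∀ i, 0 < formL (sroot i) x) : formL α x ≠ 0 := by
  obtain ⟨-, -, -, -, hne, -⟩ := hα.exists_halfNorm
  rcases hne.lt_or_gt with h | h
  · have := hα.neg.formL_pos (by rw [map_neg]; linarith) hx
    rw [map_neg, LinearMap.neg_apply] at this
    exact (neg_pos.1 this).ne
  · exact (hα.formL_pos h hx).ne'

theorem openChamber_subset : openChamber ⊆ regularSet posCone := fun _ hx =>
  ⟨⟨hx.1, hx.2.1⟩, fun _ hα => hα.formL_ne_zero hx.2.2⟩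

/-- The positive multiple of norm `1` of a positive norm vector. -/
noncomputable def normalize (x : Ambient) : Ambient := (√(formL x x))⁻¹ • x

theorem normalize_mem {x : Ambient} (hx : x ∈ posCone) :
    normalize x ∈ posCone ∧ formL (normalize x) (normalize x) = 1 := by
  have h := Real.sqrt_pos.2 hx.1
  refine ⟨smul_mem_posCone hx (inv_pos.2 h), ?_⟩
  simp only [normalize, map_smul, LinearMap.smul_apply, smul_eq_mul]
  have := Real.mul_self_sqrt hx.1.le
  field_simp
  rw [sq, this]

theorem normalize_openChamber {x : Ambient} (hx : x ∈ posCone) (h : ∀ i, 0 < formL (sroot i) x) :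
    normalize x ∈ openChamber := by
  refine ⟨(normalize_mem hx).1, (normalize_mem hx).2, fun i => ?_⟩
  rw [normalize, map_smul]
  exact mul_pos (inv_pos.2 (Real.sqrt_pos.2 hx.1)) (h i)

theorem normalize_closedChamber {x : Ambient} (hx : x ∈ posCone)
    (h : ∀ i, 0 ≤ formL (sroot i) x) : normalize x ∈ closedChamber := by
  refine ⟨(normalize_mem hx).1, (normalize_mem hx).2, fun i => ?_⟩
  rw [normalize, map_smul]
  exact mul_nonneg (inv_pos.2 (Real.sqrt_pos.2 hx.1)).le (h i)

theorem normalize_of_eq_one {x : Ambient} (hx : formL x x = 1) : normalize x = x := by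
  simp [normalize, hx]

theorem continuousOn_normalize : ContinuousOn normalize posCone := by
  refine ContinuousOn.smul (ContinuousOn.inv₀ ?_ fun x hx => (Real.sqrt_pos.2 hx.1).ne')
    continuousOn_id
  exact continuous_formL_self.sqrt.continuousOn

theorem formL_sroot_wv (i : Fin 8) : 0 < formL (sroot i) wv := by
  rw [formL_comm, formL_wv_sroot]
  exact_mod_cast sd_pos i

theorem isPreconnected_openChamber : IsPreconnected openChamber := by
  have hconv : Convex ℝ {x | x ∈ posCone ∧ ∀ i, 0 < formL (sroot i) x} := by
    rw [Set.ofPred_and, Set.ofPred_forall]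
    refine convex_posCone.inter (convex_iInter fun i => ?_)
    exact convex_halfSpace_gt (formL (sroot i)).isLinear 0
  have h := hconv.isPreconnected.image normalize (continuousOn_normalize.mono fun x hx => hx.1)
  convert h
  ext x
  constructor
  · rintro ⟨h1, h2, h3⟩
    exact ⟨x, ⟨h1, h3⟩, normalize_of_eq_one h2⟩
  · rintro ⟨y, ⟨h1, h2⟩, rfl⟩
    exact normalize_openChamber h1 h2

theorem connectedComponentIn_openChamber {x : Ambient} (hx : x ∈ openChamber) :
    connectedComponentIn (regularSet posCone) x = openChamber := by
  apply Set.Subset.antisymm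
  · intro y hy
    have hyr := connectedComponentIn_subset _ _ hy
    refine ⟨hyr.1.1, hyr.1.2, fun i => ?_⟩
    exact pos_of_isPreconnected (isPreconnected_connectedComponentIn)
      (continuous_formL (sroot i)).continuousOn
      (fun z hz => (connectedComponentIn_subset _ _ hz).2 _ (isRoot_sroot i))
      (mem_connectedComponentIn (openChamber_subset hx)) hy (hx.2.2 i)
  · exact isPreconnected_openChamber.subset_connectedComponentIn hx openChamber_subset

theorem closure_openChamber : closure openChamber = closedChamber := by
  apply Set.Subset.antisymm
  · intro x hx
    have h1 : formL x x = 1 := closure_minimal (fun y hy => hy.2.1)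
      (isClosed_eq continuous_formL_self continuous_const) hx
    have h2 : 0 ≤ x.2.1 := closure_minimal (t := {x : Ambient | 0 ≤ x.2.1})
      (fun y hy => hy.1.2.le) (isClosed_le continuous_const (by fun_prop)) hx
    refine ⟨?_, h1, fun i => ?_⟩
    · rcases mem_or_neg_mem_posCone (show 0 < formL x x by rw [h1]; norm_num) with h | h
      · exact h
      · have := h.2
        simp only [Prod.snd_neg, Prod.fst_neg] at this
        linarith
    · exact closure_minimal (t := {x : Ambient | 0 ≤ formL (sroot i) x})
        (fun y hy => (hy.2.2 i).le) (isClosed_le continuous_const (continuous_formL _)) hx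
  · rintro x ⟨h1, h2, h3⟩
    -- A small multiple of `wv`, which is interior, pushes a boundary point into the open chamber.
    have hcont : Tendsto (fun t : ℝ => x + t • wv) (𝓝[>] 0) (𝓝 x) := by
      have : Continuous fun t : ℝ => x + t • wv := by fun_prop
      simpa using (this.tendsto 0).mono_left nhdsWithin_le_nhds
    have hnorm : Tendsto (fun t : ℝ => normalize (x + t • wv)) (𝓝[>] 0) (𝓝 x) := by
      have := (continuousOn_normalize.continuousAt (isOpen_posCone.mem_nhds h1)).tendsto.comp hcont
      rwa [normalize_of_eq_one h2] at this
    refine mem_closure_of_tendsto hnorm ?_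
    filter_upwards [self_mem_nhdsWithin] with t ht
    refine normalize_openChamber (add_mem_posCone h1 (smul_mem_posCone wv_mem_posCone ht))
      fun i => ?_
    rw [map_add, map_smul, smul_eq_mul]
    exact add_pos_of_nonneg_of_pos (h3 i) (mul_pos ht (formL_sroot_wv i))

theorem normalize_wv_mem : normalize wv ∈ openChamber :=
  normalize_openChamber wv_mem_posCone formL_sroot_wv

theorem isWeylChamber_closedChamber : IsWeylChamber formL latticeL closedChamber := by
  refine ⟨posCone, isPositiveCone_posCone, normalize wv, openChamber_subset normalize_wv_mem, ?_⟩
  rw [← closure_openChamber, ← connectedComponentIn_openChamber normalize_wv_mem]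
  rfl

/-- Every point of hyperbolic space on no hyperplane is conjugate to an interior point of the
fundamental chamber. -/
theorem exists_map_mem_openChamber {x : Ambient} (hx : x ∈ regularSet posCone) :
    ∃ g ∈ simpleGroup, g x ∈ openChamber := by
  obtain ⟨g, hg, hpos⟩ := exists_map_nonneg hx.1.1
  have hgx : g x ∈ regularSet posCone := by
    have := image_regularSet (simpleGroup_le hg) posCone
    rw [image_posCone (simpleGroup_le_autPlus hg)] at this
    rw [← this]
    exact ⟨x, hx, rfl⟩
  exact ⟨g, hg, hgx.1.1, hgx.1.2, fun i =>
    lt_of_le_of_ne (hpos i) (hgx.2 _ (isRoot_sroot i)).symm⟩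

/-- Every Weyl chamber is the image of the fundamental chamber under an automorphism. -/
theorem IsWeylChamber.exists_eq_image {D : Set Ambient} (hD : IsWeylChamber formL latticeL D) :
    ∃ g ∈ autGroup formL latticeL, D = g '' closedChamber := by
  obtain ⟨C, hC, x, hx, rfl⟩ := hD
  obtain ⟨g0, hg0, hgC⟩ : ∃ g ∈ autGroup formL latticeL, g '' C = posCone := by
    rcases hC.eq_or_neg with h | h
    · exact ⟨1, one_mem _, by rw [h]; exact Set.image_id _⟩
    · exact ⟨_, neg_one_mem_autGroup, h⟩
  have hx' : x ∈ regularSet C := hx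
  have hg0x : g0 x ∈ regularSet posCone := by
    rw [← hgC, ← image_regularSet hg0]
    exact ⟨x, hx, rfl⟩
  obtain ⟨g, hg, hgx⟩ := exists_map_mem_openChamber hg0x
  have hgg := mul_mem (simpleGroup_le hg) hg0
  refine ⟨(g * g0)⁻¹, inv_mem hgg, ?_⟩
  have hCC : (g * g0 : Ambient ≃ₗ[ℝ] Ambient) '' C = posCone := by
    rw [image_mul, hgC, image_posCone (simpleGroup_le_autPlus hg)]
  rw [← closure_openChamber, ← connectedComponentIn_openChamber hgx, ← hCC,
    ← image_regularSet hgg, ← LinearEquiv.mul_apply, ← image_connectedComponentIn _ hx',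
    ← image_closure, inv_image_image]
  rfl

/-! ### Simple roots -/

theorem simpleRoots_image {g : Ambient ≃ₗ[ℝ] Ambient} (hg : g ∈ autGroup formL latticeL)
    (D : Set Ambient) :
    simpleRoots formL latticeL (g '' D) = g '' simpleRoots formL latticeL D := by
  have key : ∀ {g : Ambient ≃ₗ[ℝ] Ambient}, g ∈ autGroup formL latticeL → ∀ (D : Set Ambient),
      g '' simpleRoots formL latticeL D ⊆ simpleRoots formL latticeL (g '' D) := by
    rintro g hg D _ ⟨α, ⟨hα, hpos, hspan⟩, rfl⟩
    refine ⟨hα.map hg, ?_, ?_⟩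
    · rintro _ ⟨x, hx, rfl⟩
      rw [formL_map hg]
      exact hpos x hx
    · have h1 : {x | x ∈ g '' D ∧ formL (g α) x = 0} =
          (g : Ambient →ₗ[ℝ] Ambient) '' {x | x ∈ D ∧ formL α x = 0} := by
        ext y
        constructor
        · rintro ⟨⟨x, hx, rfl⟩, h⟩
          exact ⟨x, ⟨hx, by rwa [formL_map hg] at h⟩, rfl⟩
        · rintro ⟨x, ⟨hx, h⟩, rfl⟩
          exact ⟨⟨x, hx, rfl⟩, (formL_map hg α x).trans h⟩
      rw [h1, Submodule.span_image, hspan]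
      ext y
      rw [Submodule.mem_map]
      constructor
      · rintro ⟨x, hx, rfl⟩
        exact (formL_map hg α x).trans hx
      · intro hy
        have hgy : g (g⁻¹ y) = y := g.apply_symm_apply y
        refine ⟨g⁻¹ y, ?_, hgy⟩
        rw [LinearMap.mem_ker] at hy ⊢
        rw [← formL_map hg, hgy, hy]
  apply Set.Subset.antisymm _ (key hg D)
  have h := Set.image_mono (f := g) (key (inv_mem hg) (g '' D))
  rw [inv_image_image, ← image_mul, mul_inv_cancel] at h
  simpa using h

theorem sroot_mem_simpleRoots (i : Fin 8) :
    sroot i ∈ simpleRoots formL latticeL closedChamber := by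
  refine ⟨isRoot_sroot i, fun x hx => hx.2.2 i, le_antisymm ?_ fun v hv => ?_⟩
  · rw [Submodule.span_le]
    exact fun x hx => hx.2
  · have hv : formL (sroot i) v = 0 := hv
    have hsd := fun j => (show (0 : ℝ) < sd j by exact_mod_cast sd_pos j)
    -- This is the projection of `wv` to the hyperplane of `sroot i`. It lies strictly inside the
    -- other seven half-spaces.
    set p : Ambient := wv + (1 / 2 : ℝ) • sroot i with hp
    have hpi : formL (sroot i) p = 0 := by
      rw [hp, map_add, map_smul, formL_comm, formL_wv_sroot, formL_sroot_self, smul_eq_mul]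
      ring
    have hpj : ∀ j, j ≠ i → 0 < formL (sroot j) p := by
      intro j hj
      rw [hp, map_add, map_smul, formL_sroot, smul_eq_mul]
      have h1 := formL_sroot_wv j
      have h2 : (0 : ℝ) ≤ gram j i := by exact_mod_cast gram_nonneg hj
      linarith
    have hpp : p ∈ posCone := by
      have h2 := hsd i
      refine mem_posCone_of_formL_pos wv_mem_posCone ?_ ?_
      · have h3 : formL (sroot i) wv = sd i := by rw [formL_comm, formL_wv_sroot]
        simp only [hp, map_add, map_smul, LinearMap.add_apply, LinearMap.smul_apply, smul_eq_mul,
          formL_wv_wv, formL_wv_sroot, formL_sroot_self, h3]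
        linarith
      · rw [hp, map_add, map_smul, formL_wv_wv, formL_wv_sroot, smul_eq_mul]
        linarith
    have hmem : ∀ q : Ambient, q ∈ posCone → formL (sroot i) q = 0 →
        (∀ j, j ≠ i → 0 < formL (sroot j) q) →
        q ∈ Submodule.span ℝ {x | x ∈ closedChamber ∧ formL (sroot i) x = 0} := by
      intro q hq hqi hqj
      have hn : normalize q ∈ {x | x ∈ closedChamber ∧ formL (sroot i) x = 0} := by
        refine ⟨normalize_closedChamber hq fun j => ?_, by rw [normalize, map_smul, hqi, smul_zero]⟩
        rcases eq_or_ne j i with rfl | hj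
        · exact hqi.ge
        · exact (hqj j hj).le
      have h1 := Submodule.smul_mem _ (√(formL q q)) (Submodule.subset_span (R := ℝ) hn)
      rwa [normalize, smul_inv_smul₀ (Real.sqrt_pos.2 hq.1).ne'] at h1
    have hU : IsOpen (posCone ∩ ⋂ j : Fin 8, {q : Ambient | j ≠ i → 0 < formL (sroot j) q}) := by
      refine isOpen_posCone.inter (isOpen_iInter_of_finite fun j => ?_)
      by_cases hj : j = i
      · simp [hj]
      · simpa [hj] using isOpen_lt continuous_const (continuous_formL (sroot j))
    have hcont : Continuous fun t : ℝ => p + t • v := by fun_prop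
    have hnear := (hU.preimage hcont).mem_nhds (x := 0)
      ⟨by simpa using hpp, Set.mem_iInter.2 fun j hj => by simpa using hpj j hj⟩
    obtain ⟨ε, hε, hball⟩ := Metric.mem_nhds_iff.1 hnear
    obtain ⟨hq1, hq2⟩ := hball (show ε / 2 ∈ Metric.ball (0 : ℝ) ε by
      rw [Metric.mem_ball, dist_zero_right, Real.norm_of_nonneg (by linarith)]; linarith)
    have hqv := hmem (p + (ε / 2) • v) hq1 (by rw [map_add, map_smul, hpi, hv]; simp)
      fun j hj => Set.mem_iInter.1 hq2 j hj
    -- Any `v` in the hyperplane is a multiple of the difference of two points, `p + (ε / 2) • v`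
    -- and `p`, both in the cone over the face.
    have hpv := hmem p hpp hpi hpj
    have h3 := Submodule.smul_mem _ (ε / 2)⁻¹ (Submodule.sub_mem _ hqv hpv)
    rwa [add_sub_cancel_left, inv_smul_smul₀ (by linarith)] at h3

theorem simpleRoots_closedChamber :
    simpleRoots formL latticeL closedChamber = Set.range sroot := by
  apply Set.Subset.antisymm
  · rintro α ⟨hα, hpos, hspan⟩
    have hwα : 0 < formL wv α := by
      obtain ⟨-, -, -, -, hne, -⟩ := hα.exists_halfNorm
      have h1 := hpos _ (closure_openChamber ▸ subset_closure normalize_wv_mem)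
      rw [normalize, map_smul, smul_eq_mul] at h1
      have h2 := nonneg_of_mul_nonneg_right h1 (inv_pos.2 (Real.sqrt_pos.2 wv_mem_posCone.1))
      rw [formL_comm] at h2
      exact lt_of_le_of_ne h2 hne.symm
    obtain ⟨⟨c, hc, hsum⟩, -⟩ := hα.positive hwα
    obtain ⟨j, hj⟩ : ∃ j, c j ≠ 0 := by
      by_contra! h
      exact hα.ne_zero (by rw [hsum]; simp [h])
    -- On the face, a sum of nonnegative terms vanishes, so the term with `c j ≠ 0` does too. As the
    -- face spans the hyperplane of `α`, this makes `sroot j` a multiple of `α`; primitivity of both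
    -- leaves only the sign.
    have hker : LinearMap.ker (formL α) ≤ LinearMap.ker (formL (sroot j)) := by
      rw [← hspan, Submodule.span_le]
      rintro x ⟨hx, hαx⟩
      rw [hsum, map_sum, LinearMap.sum_apply] at hαx
      simp only [map_smul, LinearMap.smul_apply, smul_eq_mul] at hαx
      have := (Finset.sum_eq_zero_iff_of_nonneg
        (fun i _ => mul_nonneg (hc i) (hx.2.2 i))).1 hαx j (Finset.mem_univ _)
      exact (mul_eq_zero.1 this).resolve_left hj
    have hαα := hα.2.1.ne
    have hprop : (formL (sroot j) α / formL α α) • α = sroot j := by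
      refine eq_of_formL_sroot fun i => ?_
      have h1 : sroot i - (formL α (sroot i) / formL α α) • α ∈ LinearMap.ker (formL α) := by
        rw [LinearMap.mem_ker, map_sub, map_smul, smul_eq_mul, div_mul_cancel₀ _ hαα, sub_self]
      have h2 := hker h1
      rw [LinearMap.mem_ker, map_sub, map_smul, smul_eq_mul] at h2
      rw [map_smul, LinearMap.smul_apply, smul_eq_mul]
      field_simp at h2 ⊢
      linarith
    obtain ⟨n, hn⟩ := hα.1.int_of_smul_mem (hprop ▸ (isRoot_sroot j).1.1)
    rw [hn, Int.cast_smul_eq_zsmul] at hprop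
    have hunit := (isRoot_sroot j).1.2 n α hα.1.1 hprop.symm
    rcases Int.isUnit_iff.1 hunit with rfl | rfl
    · exact ⟨j, by rw [← hprop, one_smul]⟩
    · exfalso
      have h1 := formL_sroot_wv j
      rw [← hprop, formL_comm, neg_smul, one_smul, map_neg] at h1
      linarith
  · rintro _ ⟨i, rfl⟩
    exact sroot_mem_simpleRoots i

theorem setOf_root_eq : {α | IsRoot formL latticeL α ∧ formL rho α = formL α α / 2} =
    Set.range sroot := by
  have hw : ∀ α, formL rho α = -formL wv α := fun α => by rw [wv_eq]; simp
  ext α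
  constructor
  · rintro ⟨hα, h⟩
    obtain ⟨d, -, hnorm, -, -, himp⟩ := hα.exists_halfNorm
    obtain ⟨i, rfl⟩ := himp (by rw [hw, hnorm] at h; linarith)
    exact ⟨i, rfl⟩
  · rintro ⟨i, rfl⟩
    refine ⟨isRoot_sroot i, ?_⟩
    rw [hw, formL_wv_sroot, formL_sroot_self]
    ring

/-! ### The diagram automorphism and the index -/

/-- The diagram automorphism, which changes the signs of the second and fourth coordinates. -/
noncomputable def diagramAut : Ambient ≃ₗ[ℝ] Ambient :=
  LinearEquiv.ofInvolutive
    { toFun := fun x => (![x.1 0, -x.1 1, x.1 2, -x.1 3], x.2)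
      map_add' := fun x y => by
        apply ambient_ext <;> simp <;> ring
      map_smul' := fun c x => by
        apply ambient_ext <;> simp }
    (fun x => by apply ambient_ext <;> simp)

theorem diagramAut_apply (x : Ambient) :
    diagramAut x = (![x.1 0, -x.1 1, x.1 2, -x.1 3], x.2) := rfl

theorem diagramAut_diagramAut (x : Ambient) : diagramAut (diagramAut x) = x := by
  apply ambient_ext <;> simp [diagramAut_apply]

theorem diagramAut_vec (v : Fin 6 → ℤ) :
    diagramAut (vec v) = vec ![v 0, -v 1, v 2, -v 3, v 4, v 5] := by
  apply ambient_ext <;> simp [diagramAut_apply, vec] <;> ring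

theorem diagramAut_mem : diagramAut ∈ autGroup formL latticeL := by
  have key : ∀ x ∈ latticeL, diagramAut x ∈ latticeL := by
    intro x hx
    obtain ⟨v, ⟨h1, h2, h3, h4⟩, rfl⟩ := (mem_latticeL_iff x).1 hx
    rw [diagramAut_vec]
    apply vec_mem
    simp only [InL, Matrix.cons_val]
    omega
  refine ⟨fun x y => ?_, fun x => ⟨fun h => ?_, key x⟩⟩
  · simp only [formL_apply, diagramAut_apply, Matrix.cons_val]
    ring
  · rw [← diagramAut_diagramAut x]
    exact key _ h

theorem diagramAut_wv : diagramAut wv = wv := by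
  rw [wv, diagramAut_vec]
  congr 1

theorem diagramAut_sroot (i : Fin 8) : diagramAut (sroot i) = sroot (2 - i) := by
  rw [sroot, diagramAut_vec, sroot]
  congr 1
  revert i
  decide

theorem diagramAut_mem_autPlus : diagramAut ∈ autPlus formL latticeL :=
  mem_autPlus diagramAut_mem wv_mem_posCone (by rw [diagramAut_wv]; exact wv_mem_posCone)

/-- The symmetry fixes `wv` without being the identity, contrary to the free action on the orbit of
`wv`. -/
theorem diagramAut_notMem : diagramAut ∉ simpleGroup := by
  intro h
  have h1 := eq_one_of_map_wv h diagramAut_wv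
  have h2 := diagramAut_sroot 0
  rw [h1] at h2
  exact absurd (sroot_injective h2) (by decide)

/-- The diagram has exactly one nontrivial automorphism. -/
theorem eq_or_eq_of_gram {π : Fin 8 → Fin 8} (h : ∀ i j, gram (π i) (π j) = gram i j) :
    (∀ i, π i = i) ∨ ∀ i, π i = 2 - i := by
  -- Norms fix the vertices 1 and 5 and send 0 to 0 or 2. Inner products with vertices already
  -- placed then determine the rest around the cycle.
  have u1 : ∀ a, gram a a = gram 1 1 → a = 1 := by decide
  have u5 : ∀ a, gram a a = gram 5 5 → a = 5 := by decide
  have u0 : ∀ a, gram a a = gram 0 0 → a = 0 ∨ a = 2 := by decide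
  have v7 : ∀ a, gram 0 a = gram 0 7 → gram a a = gram 7 7 → a = 7 := by decide
  have v6 : ∀ a, gram 7 a = gram 7 6 → gram a a = gram 6 6 → a = 6 := by decide
  have v2 : ∀ a, gram 0 a = gram 0 2 → gram 7 a = gram 7 2 → gram a a = gram 2 2 → a = 2 := by
    decide
  have v3 : ∀ a, gram 2 a = gram 2 3 → gram a a = gram 3 3 → a = 3 := by decide
  have v4 : ∀ a, gram 3 a = gram 3 4 → gram a a = gram 4 4 → a = 4 := by decide
  have w7 : ∀ a, gram 2 a = gram 0 7 → gram a a = gram 7 7 → a = 3 := by decide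
  have w6 : ∀ a, gram 3 a = gram 7 6 → gram a a = gram 6 6 → a = 4 := by decide
  have w2 : ∀ a, gram 2 a = gram 0 2 → gram 3 a = gram 7 2 → gram a a = gram 2 2 → a = 0 := by
    decide
  have w3 : ∀ a, gram 0 a = gram 2 3 → gram a a = gram 3 3 → a = 7 := by decide
  have w4 : ∀ a, gram 7 a = gram 3 4 → gram a a = gram 4 4 → a = 6 := by decide
  have h1 := u1 _ (h 1 1)
  have h5 := u5 _ (h 5 5)
  rcases u0 _ (h 0 0) with h0 | h0
  · left
    have h7 := v7 _ (by rw [← h 0 7, h0]) (h 7 7)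
    have h6 := v6 _ (by rw [← h 7 6, h7]) (h 6 6)
    have h2 := v2 _ (by rw [← h 0 2, h0]) (by rw [← h 7 2, h7]) (h 2 2)
    have h3 := v3 _ (by rw [← h 2 3, h2]) (h 3 3)
    have h4 := v4 _ (by rw [← h 3 4, h3]) (h 4 4)
    intro i
    fin_cases i <;> assumption
  · right
    have h7 := w7 _ (by rw [← h 0 7, h0]) (h 7 7)
    have h6 := w6 _ (by rw [← h 7 6, h7]) (h 6 6)
    have h2 := w2 _ (by rw [← h 0 2, h0]) (by rw [← h 7 2, h7]) (h 2 2)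
    have h3 := w3 _ (by rw [← h 2 3, h2]) (h 3 3)
    have h4 := w4 _ (by rw [← h 3 4, h3]) (h 4 4)
    intro i
    fin_cases i <;> assumption

theorem eq_of_sroot_eq {g h : Ambient ≃ₗ[ℝ] Ambient} (hg : g ∈ autGroup formL latticeL)
    (hh : h ∈ autGroup formL latticeL) (heq : ∀ i, g (sroot i) = h (sroot i)) : g = h := by
  ext1 x
  have hx : h (h⁻¹ (g x)) = g x := h.apply_symm_apply _
  rw [← hx]
  congr 1
  refine eq_of_formL_sroot fun i => ?_
  rw [← formL_map hh, hx, ← heq, formL_map hg]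

theorem eq_one_or_eq_diagramAut {g : Ambient ≃ₗ[ℝ] Ambient} (hg : g ∈ autGroup formL latticeL)
    (h : g '' closedChamber = closedChamber) : g = 1 ∨ g = diagramAut := by
  have h1 := simpleRoots_image hg closedChamber
  rw [h, simpleRoots_closedChamber] at h1
  have h2 : ∀ i, ∃ j, sroot j = g (sroot i) := fun i =>
    h1.ge ⟨sroot i, ⟨i, rfl⟩, rfl⟩
  choose π hπ using h2
  have hgram : ∀ i j, gram (π i) (π j) = gram i j := by
    intro i j
    have : (gram (π i) (π j) : ℝ) = gram i j := by
      rw [← formL_sroot, ← formL_sroot, hπ, hπ, formL_map hg]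
    exact_mod_cast this
  rcases eq_or_eq_of_gram hgram with h3 | h3
  · left
    exact eq_of_sroot_eq hg (one_mem _) fun i => by rw [← hπ, h3]; rfl
  · right
    exact eq_of_sroot_eq hg diagramAut_mem fun i => by rw [← hπ, h3, diagramAut_sroot]

/-- An element of `W` brings the image of an interior point back into the open chamber, so the
product preserves that component of the regular set. -/
theorem exists_mul_eq {g : Ambient ≃ₗ[ℝ] Ambient} (hg : g ∈ autPlus formL latticeL) :
    ∃ u ∈ simpleGroup, u * g = 1 ∨ u * g = diagramAut := by
  have hx : g (normalize wv) ∈ regularSet posCone := by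
    rw [← image_posCone hg, ← image_regularSet hg.1]
    exact ⟨_, openChamber_subset normalize_wv_mem, rfl⟩
  obtain ⟨u, hu, hux⟩ := exists_map_mem_openChamber hx
  have hug := mul_mem (simpleGroup_le_autPlus hu) hg
  refine ⟨u, hu, eq_one_or_eq_diagramAut hug.1 ?_⟩
  rw [← closure_openChamber, image_closure]
  congr 1
  rw [← connectedComponentIn_openChamber normalize_wv_mem,
    image_connectedComponentIn _ (openChamber_subset normalize_wv_mem), image_regularSet hug.1,
    image_posCone hug, connectedComponentIn_openChamber normalize_wv_mem]
  exact connectedComponentIn_openChamber hux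

theorem relIndex_simpleGroup : simpleGroup.relIndex (autPlus formL latticeL) = 2 := by
  rw [Subgroup.relIndex, Subgroup.index_eq_two_iff]
  have hinv : diagramAut * diagramAut = 1 := LinearEquiv.ext diagramAut_diagramAut
  refine ⟨⟨diagramAut, diagramAut_mem_autPlus⟩, ?_⟩
  rintro ⟨g, hg⟩
  simp only [Subgroup.mem_subgroupOf, Subgroup.coe_mul]
  obtain ⟨u, hu, h | h⟩ := exists_mul_eq hg
  · obtain rfl := eq_inv_of_mul_eq_one_right h
    exact Or.inr ⟨inv_mem hu, fun hn => diagramAut_notMem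
      ((Subgroup.mul_mem_cancel_left _ (inv_mem hu)).1 hn)⟩
  · obtain rfl : g = u⁻¹ * diagramAut := by rw [← h, inv_mul_cancel_left]
    refine Or.inl ⟨?_, fun hn => diagramAut_notMem
      ((Subgroup.mul_mem_cancel_left _ (inv_mem hu)).1 hn)⟩
    rw [mul_assoc, hinv, mul_one]
    exact inv_mem hu

/-! ### The Dynkin diagram and the uniqueness of the Weyl vector -/

theorem hasDynkinDiagram_image {g : Ambient ≃ₗ[ℝ] Ambient} (hg : g ∈ autGroup formL latticeL) :
    HasDynkinDiagram formL (g '' Set.range sroot) cycleDiagram := by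
  refine ⟨g ∘ sroot, g.injective.comp sroot_injective, Set.range_comp g sroot, fun i j hij => ?_⟩
  have h : ∀ i j, i ≠ j → 4 * gram i j ^ 2 = cycleDiagram i j * (gram i i * gram j j) := by decide
  simp only [Function.comp_apply, formL_map hg, formL_sroot]
  exact ⟨by exact_mod_cast gram_nonneg hij, by exact_mod_cast h i j hij⟩

theorem isWeylVector_iff (ρ' : Ambient) :
    IsWeylVector formL latticeL closedChamber ρ' ↔ ρ' = rho := by
  have hrho : ∀ i, formL rho (sroot i) = formL (sroot i) (sroot i) / 2 := fun i =>
    (setOf_root_eq.ge ⟨i, rfl⟩).2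
  rw [IsWeylVector, simpleRoots_closedChamber, Set.forall_mem_range]
  constructor
  · intro h
    exact eq_of_formL_sroot fun i => by rw [h, hrho]
  · rintro rfl
    exact hrho

end HypLattice

open HypLattice
theorem mainTheorem9 :
    (∀ D : Set Ambient, IsWeylChamber formL latticeL D →
      (simpleRoots formL latticeL D).ncard = 8 ∧
      HasDynkinDiagram formL (simpleRoots formL latticeL D) cycleDiagram) ∧
    (∃ D : Set Ambient, IsWeylChamber formL latticeL D ∧
      simpleRoots formL latticeL D =
        {α | IsRoot formL latticeL α ∧ formL rho α = formL α α / 2} ∧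
      ∀ ρ' : Ambient, IsWeylVector formL latticeL D ρ' ↔ ρ' = rho) ∧
    formL rho rho = 28 ∧
    reflectionGroup formL latticeL ≤ autPlus formL latticeL ∧
    (reflectionGroup formL latticeL).relIndex (autPlus formL latticeL) = 2 := by
  refine ⟨fun D hD => ?_, ⟨closedChamber, isWeylChamber_closedChamber, ?_, isWeylVector_iff⟩,
    ?_, ?_, ?_⟩
  · obtain ⟨g, hg, rfl⟩ := hD.exists_eq_image
    rw [simpleRoots_image hg, simpleRoots_closedChamber]
    refine ⟨?_, hasDynkinDiagram_image hg⟩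
    rw [Set.ncard_image_of_injective _ g.injective, ← Set.image_univ,
      Set.ncard_image_of_injective _ sroot_injective, Set.ncard_univ, Nat.card_fin]
  · rw [simpleRoots_closedChamber, setOf_root_eq]
  · have h := formL_wv_wv
    rw [wv_eq] at h
    simpa using h
  · rw [reflectionGroup_eq]
    exact simpleGroup_le_autPlus
  · rw [reflectionGroup_eq]
    exact relIndex_simpleGroup
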